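/- **Setting.** Consider a periodic-review single-item inventory system with backlogging and two suppliers: a regular one with lead time $l^r$ and an expedited one with lead time $l^e$, where $l^e<l^r$ are non-negative integers, and let $l=l^r-l^e$. The demands $D_0,D_1,\dots$ are non-negative i.i.d. random variables that are not almost surely constant. An admissible policy chooses in every period $t$ non-negative orders $q^e_t$ (expedited) and $q^r_t$ (regular) as measurable functions of the demands observed before period $t$. The system starts empty: orders with negative index are $0$, and the net inventory facing the demand of period $t$ is $$I_t=\sum_{i=0}^{t-l^e}q^e_i+\sum_{i=0}^{t-l^r}q^r_i-\sum_{i=0}^{t-1}D_i ,$$ so that $I_{t}=I_{t-1}-D_{t-1}+q^e_{t-l^e}+q^r_{t-l^r}$ for $t\ge 1$. With holding cost $h>0$, backlog cost $p>0$ and expediting premium $c^e>0$ (regular unit price $0$), the cost of period $t$ is $C_t=c^e q^e_t+h\,(I_t-D_t)^++p\,(D_t-I_t)^+$, and the long-run average cost of a policy is $\limsup_{T\to\infty}\frac1T\sum_{t=1}^T\mathbb E[C_t]$. Let $C^{\pi^*}(p,c^e)$ be the infimum of the long-run average cost over all admissible policies. The expedited inventory position just before the expedited order of period $t$ is $IP^e_t=\sum_{i=0}^{t-1}q^e_i+\sum_{i=0}^{t-l}q^r_i-\sum_{i=0}^{t-1}D_i$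 (net inventory plus all outstanding orders that arrive by period $t+l^e$). For real parameters $S^e$ and $U$, a projected expedited inventory position (PEIP) policy is an admissible policy with, in every period $t\ge 0$, $q^e_t=(S^e-IP^e_t)^+$ and $q^r_t$ such that $IP^e_{t+l}$ is integrable and its conditional expectation given the demands before period $t$ equals $U$ almost surely. Let $C^{PEIP^*}(p,c^e)$ be the infimum of the long-run average cost over all PEIP policies and all parameters $S^e,U$. **Theorem.** Let $c^e/p<l$. Suppose that the demand over $l^r+1$ periods, $\mathbf D=D_0+\dots+D_{l^r}$, satisfies $0<\mathbb E[\mathbf D]<\infty$ and that either $\mathbf D$ is bounded, or $\mathbf D$ is unbounded and $\lim_{d\to\infty}\mathbb E[\mathbf D-d\mid \mathbf D>d]/d=0$. Then, with $h$, $l^e$, $l^r$ and the demand distribution fixed, $$\lim_{n\to\infty}\frac{C^{PEIP^*}(np,\,nc^e)}{C^{\pi^*}(np,\,nc^e)}=1 .$$ -/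

import Mathlib

open MeasureTheory ProbabilityTheory Filter Topology
open scoped ENNReal

namespace DualSourcing

/-- The information available when the orders of period `t` are placed: the demands of the
periods `0, …, t - 1`. The system starts empty, so past orders and the current state are
functions of these demands. -/
abbrev history {Ω : Type*} (D : ℕ → Ω → ℝ) (t : ℕ) : MeasurableSpace Ω :=
  ⨆ i : Fin t, MeasurableSpace.comap (D i) inferInstance

/-- An admissible policy for the demand process `D`: non-negative orders with the expedited and
the regular supplier in every period, each based only on the information available then. -/
structure Policy {Ω : Type*} (D : ℕ → Ω → ℝ) where
  /-- `expedited t` is the order placed with the expedited supplier in period `t`. -/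
  expedited : ℕ → Ω → ℝ
  /-- `regular t` is the order placed with the regular supplier in period `t`. -/
  regular : ℕ → Ω → ℝ
  expedited_nonneg : ∀ t ω, 0 ≤ expedited t ω
  regular_nonneg : ∀ t ω, 0 ≤ regular t ω
  expedited_adapted : ∀ t, Measurable[history D t] (expedited t)
  regular_adapted : ∀ t, Measurable[history D t] (regular t)

noncomputable section

namespace Policy

variable {Ω : Type*} {D : ℕ → Ω → ℝ}

/-- Net inventory `I_t` (on hand minus backlog) facing the demand of period `t`: the expedited
orders placed in periods `i ≤ t - le` and the regular orders placed in periods `i ≤ t - lr`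
have arrived, and the demands of the periods before `t` have been subtracted. -/
def netInventory (π : Policy D) (le lr t : ℕ) (ω : Ω) : ℝ :=
  ∑ i ∈ Finset.range (t + 1 - le), π.expedited i ω
    + ∑ i ∈ Finset.range (t + 1 - lr), π.regular i ω
    - ∑ i ∈ Finset.range t, D i ω

/-- Expedited inventory position `IP^e_t`, just before the expedited order of period `t` is
placed: net inventory plus all outstanding orders that arrive by period `t + le`, that is, all
expedited orders placed before period `t` and all regular orders placed in periods
`i ≤ t - (lr - le)`, minus the demands of the periods before `t`. -/
def expeditedPosition (π : Policy D) (le lr t : ℕ) (ω : Ω) : ℝ :=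
  ∑ i ∈ Finset.range t, π.expedited i ω
    + ∑ i ∈ Finset.range (t + 1 - (lr - le)), π.regular i ω
    - ∑ i ∈ Finset.range t, D i ω

/-- The system starts empty. -/
theorem netInventory_zero (π : Policy D) (le lr : ℕ) (hle : 1 ≤ le) (hl : le < lr) (ω : Ω) :
    π.netInventory le lr 0 ω = 0 := by
  simp [netInventory, Nat.sub_eq_zero_of_le hle,
    Nat.sub_eq_zero_of_le (le_trans hle hl.le)]

/-- The inventory recursion `I_{t+1} = I_t - D_t + q^e_{t+1-le} + q^r_{t+1-lr}`, where orders
with a negative index are zero. -/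
theorem netInventory_succ (π : Policy D) (le lr t : ℕ) (ω : Ω) :
    π.netInventory le lr (t + 1) ω = π.netInventory le lr t ω - D t ω
      + (if le ≤ t + 1 then π.expedited (t + 1 - le) ω else 0)
      + (if lr ≤ t + 1 then π.regular (t + 1 - lr) ω else 0) := by
  have key : ∀ (q : ℕ → ℝ) (k : ℕ), ∑ i ∈ Finset.range (t + 1 + 1 - k), q i
      = ∑ i ∈ Finset.range (t + 1 - k), q i + (if k ≤ t + 1 then q (t + 1 - k) else 0) := by
    intro q k
    split_ifs with h
    · rw [Nat.sub_add_comm h, Finset.sum_range_succ]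
    · rw [Nat.sub_eq_zero_of_le (by omega), Nat.sub_eq_zero_of_le (by omega)]; simp
  simp only [netInventory]
  rw [key (fun i => π.expedited i ω), key (fun i => π.regular i ω), Finset.sum_range_succ]
  ring

/-- For `1 ≤ le`, the expedited inventory position is the net inventory plus the expedited
orders of the periods `t - le + 1, …, t - 1` and the regular orders of the periods
`t - lr + 1, …, t - (lr - le)`. -/
theorem expeditedPosition_eq (π : Policy D) (le lr t : ℕ) (hle : 1 ≤ le) (hl : le < lr) (ω : Ω) :
    π.expeditedPosition le lr t ω = π.netInventory le lr t ω
      + ∑ i ∈ Finset.Ico (t + 1 - le) t, π.expedited i ω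
      + ∑ i ∈ Finset.Ico (t + 1 - lr) (t + 1 - (lr - le)), π.regular i ω := by
  simp only [expeditedPosition, netInventory]
  rw [← Finset.sum_range_add_sum_Ico (fun i => π.expedited i ω) (show t + 1 - le ≤ t by omega),
    ← Finset.sum_range_add_sum_Ico (fun i => π.regular i ω)
      (show t + 1 - lr ≤ t + 1 - (lr - le) by omega)]
  ring

/-- For `le = 0`, an expedited order arrives at once, and the expedited inventory position is
the net inventory without the expedited order of the current period. -/
theorem expeditedPosition_zero_leadTime (π : Policy D) (lr t : ℕ) (ω : Ω) :
    π.expeditedPosition 0 lr t ω = π.netInventory 0 lr t ω - π.expedited t ω := by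
  simp only [expeditedPosition, netInventory, Nat.sub_zero, Finset.sum_range_succ]
  ring

/-- Cost of period `t`, with expediting premium `ce` per unit (and regular unit price `0`),
backlog penalty `p` and holding cost `h`. -/
def cost (π : Policy D) (p h ce : ℝ) (le lr t : ℕ) (ω : Ω) : ℝ :=
  ce * π.expedited t ω + h * max (π.netInventory le lr t ω - D t ω) 0
    + p * max (D t ω - π.netInventory le lr t ω) 0

/-- Long-run average expected cost per period, `limsup_T (1/T) ∑_{t=1}^T E[C_t]`, in `[0, ∞]`. -/
def averageCost [MeasurableSpace Ω] (μ : Measure Ω) (π : Policy D) (p h ce : ℝ) (le lr : ℕ) :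
    ℝ≥0∞ :=
  limsup (fun T : ℕ =>
    (∑ t ∈ Finset.Icc 1 T, ∫⁻ ω, ENNReal.ofReal (π.cost p h ce le lr t ω) ∂μ) / (T : ℝ≥0∞)) atTop

/-- `π` is the projected expedited inventory position policy with expedited order-up-to level `S`
and projected expedited inventory position level `U`: expedited orders raise the expedited
inventory position to `S` if it is below `S`, and in every period `t` the regular order, which
enters the expedited inventory position in period `t + (lr - le)`, is such that the conditional
expectation of that position given the information in period `t` equals `U`. -/
structure IsPEIP [MeasurableSpace Ω] (μ : Measure Ω) (π : Policy D) (le lr : ℕ) (S U : ℝ) :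
    Prop where
  expedited_eq : ∀ t ω, π.expedited t ω = max (S - π.expeditedPosition le lr t ω) 0
  integrable : ∀ t, Integrable (π.expeditedPosition le lr (t + (lr - le))) μ
  projected : ∀ t, μ[π.expeditedPosition le lr (t + (lr - le)) | history D t] =ᵐ[μ] fun _ => U

end Policy

/-- Optimal long-run average cost over all admissible dual-sourcing policies. -/
def optimalCost {Ω : Type*} [MeasurableSpace Ω] (μ : Measure Ω) (D : ℕ → Ω → ℝ)
    (p h ce : ℝ) (le lr : ℕ) : ℝ≥0∞ :=
  ⨅ π : Policy D, π.averageCost μ p h ce le lr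

/-- Long-run average cost of the best PEIP policy: the infimum over both policy parameters. -/
def bestPEIPCost {Ω : Type*} [MeasurableSpace Ω] (μ : Measure Ω) (D : ℕ → Ω → ℝ)
    (p h ce : ℝ) (le lr : ℕ) : ℝ≥0∞ :=
  ⨅ (S : ℝ) (U : ℝ) (π : Policy D) (_ : π.IsPEIP μ le lr S U), π.averageCost μ p h ce le lr

/-- `X` is (essentially) bounded above. -/
def IsBoundedAbove {Ω : Type*} [MeasurableSpace Ω] (μ : Measure Ω) (X : Ω → ℝ) : Prop :=
  ∃ M : ℝ, ∀ᵐ ω ∂μ, X ω ≤ M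

/-- `X` has a positive finite mean, and either it is bounded, or it is unbounded and
`E[X - d | X > d] / d → 0` as `d → ∞`. -/
structure DemandCondition {Ω : Type*} [MeasurableSpace Ω] (μ : Measure Ω) (X : Ω → ℝ) :
    Prop where
  integrable : Integrable X μ
  mean_pos : 0 < ∫ ω, X ω ∂μ
  tail : IsBoundedAbove μ X ∨
    (¬ IsBoundedAbove μ X ∧
      Tendsto (fun d : ℝ => (∫ ω, (X ω - d) ∂(μ[|{ω | d < X ω}])) / d) atTop (𝓝 0))

end

end DualSourcing

/-!
Both costs are compared with a newsvendor problem for the demand `X` of `lr + 1` periods, with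
holding cost `h`. Write `g_b s` for its expected cost with stock `s` and backlog cost `b`.

*Lower bound.* Let `b = n * ce / (lr - le)`, which is less than the actual backlog cost `n * p`.
With backlog cost `b`, expediting a unit costs as much as the backlog it can avoid until a regular
order placed at the same time arrives. Hence, on every sample path, the cost is at least that of
the periods `t + lr` when only the orders placed up to period `t` count for them
(`sum_periodCost_le_sum_cost`). These orders are independent of the `lr + 1` demands from `t` on,
so every policy costs at least `inf g_b` (`le_optimalCost`).

*Upper bound.* For `S ≤ 0 ≤ U` a PEIP policy exists. The regular order that achieves the
projection `U` is non-negative because the projection of the next period, even after zero demand,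
is at most the old one plus the order just placed (`projectedPosition_shift_le`). As `S → -∞`,
expedited orders vanish in mean, uniformly in time, since they require that the demand of a few
periods exceeds `U - S` (`IsPEIP.expedited_le`). In the limit the policy is a base-stock policy
with the regular supplier, whose cost is `g_{n p}` at a stock level that can be any number above
`E[X]` (`bestPEIPCost_le`).

*Comparison.* It remains to see that a constant factor in the backlog cost does not matter as
`n → ∞` (`DemandCondition.eventually_newsvendorCost_le`). If `X` is bounded, then stocking its
essential supremum is asymptotically optimal for both problems. If `X` is unbounded, the tail
condition says that `E[(X - s)^+]` is rapidly varying (`eventually_mul_meanExcess_le`): raising a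
high stock level by a small proportion `ε` divides the expected backlog by any given factor, while
the holding cost grows only by a proportion of order `ε`. As the demand is not constant, the lower
bound is positive, so the ratio of the costs is well defined, and it tends to `1`.
-/

/-! ### Demand process -/

namespace DualSourcing

section Demand

variable {Ω : Type*} {D : ℕ → Ω → ℝ}

theorem history_eq_iSup (D : ℕ → Ω → ℝ) (t : ℕ) :
    history D t = ⨆ i ∈ Set.Iio t, MeasurableSpace.comap (D i) inferInstance := by
  apply le_antisymm
  · exact iSup_le fun i => le_iSup₂_of_le (i : ℕ) i.2 le_rfl
  · exact iSup₂_le fun i hi => le_iSup_of_le (⟨i, hi⟩ : Fin t) le_rfl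

theorem history_mono (D : ℕ → Ω → ℝ) {s t : ℕ} (h : s ≤ t) : history D s ≤ history D t := by
  rw [history_eq_iSup, history_eq_iSup]
  exact biSup_mono fun i hi => lt_of_lt_of_le hi h

theorem measurable_demand_history {i t : ℕ} (h : i < t) : Measurable[history D t] (D i) := by
  rw [history_eq_iSup]
  exact (comap_measurable (D i)).mono (le_iSup₂_of_le i h le_rfl) le_rfl

/-- The demand of the `n` periods `t, …, t + n - 1`. -/
def blockDemand (D : ℕ → Ω → ℝ) (n t : ℕ) (ω : Ω) : ℝ := ∑ i ∈ Finset.range n, D (t + i) ω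

theorem blockDemand_zero (D : ℕ → Ω → ℝ) (n : ℕ) :
    blockDemand D n 0 = fun ω => ∑ i ∈ Finset.range n, D i ω := by
  funext ω; simp [blockDemand]

theorem blockDemand_succ (D : ℕ → Ω → ℝ) (n t : ℕ) (ω : Ω) :
    blockDemand D (n + 1) t ω = blockDemand D n t ω + D (t + n) ω :=
  Finset.sum_range_succ _ n

theorem blockDemand_mono (hD : ∀ t ω, 0 ≤ D t ω) {m n : ℕ} (h : m ≤ n) (t : ℕ) (ω : Ω) :
    blockDemand D m t ω ≤ blockDemand D n t ω :=
  Finset.sum_le_sum_of_subset_of_nonneg (Finset.range_mono h) fun i _ _ => hD (t + i) ω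

theorem sum_range_add_eq (D : ℕ → Ω → ℝ) (n t : ℕ) (ω : Ω) :
    ∑ i ∈ Finset.range (t + n), D i ω = ∑ i ∈ Finset.range t, D i ω + blockDemand D n t ω :=
  Finset.sum_range_add (fun i => D i ω) t n

variable [MeasurableSpace Ω] {μ : Measure Ω}

theorem history_le (hD : ∀ t, Measurable (D t)) (t : ℕ) : history D t ≤ ‹MeasurableSpace Ω› :=
  iSup_le fun i => (hD i).comap_le

theorem measurable_blockDemand (hD : ∀ t, Measurable (D t)) (n t : ℕ) :
    Measurable (blockDemand D n t) :=
  Finset.measurable_fun_sum _ fun i _ => hD (t + i)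

/-- The demand is stationary: blocks of equal length have the same distribution. -/
theorem identDistrib_blockDemand [IsProbabilityMeasure μ]
    (hindep : iIndepFun D μ) (hident : ∀ t, IdentDistrib (D t) (D 0) μ μ) (n t : ℕ) :
    IdentDistrib (blockDemand D n t) (blockDemand D n 0) μ μ := by
  have h1 : iIndepFun (fun i : Fin n => D (t + i)) μ :=
    hindep.precomp (g := fun i : Fin n => t + (i : ℕ)) fun i j h => by
      simpa [Fin.ext_iff] using h
  have h2 : iIndepFun (fun i : Fin n => D (0 + i)) μ :=
    hindep.precomp (g := fun i : Fin n => 0 + (i : ℕ)) fun i j h => by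
      simpa [Fin.ext_iff] using h
  have h := IdentDistrib.pi (fun i : Fin n => (hident (t + i)).trans (hident (0 + i)).symm) h1 h2
  have h3 := h.comp (u := fun x : Fin n → ℝ => ∑ i, x i)
    (Finset.measurable_fun_sum _ fun i _ => measurable_pi_apply i)
  convert h3 using 1 <;>
  · funext ω
    simp [blockDemand, Finset.sum_range]

/-- The information available in period `t` is independent of all demand from period `t` on. -/
theorem indep_history_future (hD : ∀ t, Measurable (D t)) (hindep : iIndepFun D μ) (t : ℕ) :
    Indep (history D t) (⨆ i ∈ Set.Ici t, MeasurableSpace.comap (D i) inferInstance) μ := by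
  rw [history_eq_iSup]
  exact indep_iSup_of_disjoint (fun i => (hD i).comap_le) hindep
    (Set.disjoint_left.2 fun i (hi : i < t) (hi' : t ≤ i) => absurd hi (not_lt.2 hi'))

theorem indepFun_blockDemand (hD : ∀ t, Measurable (D t)) (hindep : iIndepFun D μ) (n t : ℕ)
    {E : Type*} [MeasurableSpace E] {A : Ω → E} (hA : Measurable[history D t] A) :
    IndepFun A (blockDemand D n t) μ := by
  refine indep_of_indep_of_le_right (indep_of_indep_of_le_left
    (indep_history_future hD hindep t) hA.comap_le) (Measurable.comap_le ?_)
  refine Finset.measurable_fun_sum _ fun i _ => ?_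
  exact (comap_measurable (D (t + i))).mono
    (le_iSup₂_of_le (t + i) (Nat.le_add_right t i) le_rfl) le_rfl

theorem indepFun_demand (hD : ∀ t, Measurable (D t)) (hindep : iIndepFun D μ) (t : ℕ)
    {E : Type*} [MeasurableSpace E] {A : Ω → E} (hA : Measurable[history D t] A) :
    IndepFun A (D t) μ := by
  have := indepFun_blockDemand hD hindep 1 t hA
  have h1 : blockDemand D 1 t = D t := by funext ω; simp [blockDemand]
  rwa [h1] at this

/-- Freezing: in the conditional expectation given the information of period `t`, whatever is
known in period `t` may be held fixed while the demand of period `t` is averaged out. -/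
theorem condExp_freeze [IsProbabilityMeasure μ] (hD : ∀ t, Measurable (D t))
    (hindep : iIndepFun D μ) (hident : ∀ t, IdentDistrib (D t) (D 0) μ μ) (t : ℕ)
    {E : Type*} [MeasurableSpace E] {Z : Ω → E} (hZ : Measurable[history D t] Z)
    {f : E → ℝ → ℝ} (hf : Measurable (Function.uncurry f))
    (hint : Integrable (fun ω => f (Z ω) (D t ω)) μ) :
    μ[fun ω => f (Z ω) (D t ω) | history D t] =ᵐ[μ] fun ω => ∫ ω', f (Z ω) (D 0 ω') ∂μ := by
  have hle := history_le hD t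
  have hZ' : Measurable Z := hZ.mono hle le_rfl
  set ν := μ.map (D t) with hν
  have : IsProbabilityMeasure ν := Measure.isProbabilityMeasure_map (hD t).aemeasurable
  have hfz : ∀ z, Measurable (f z) := fun z => hf.of_uncurry_left
  have hlaw : ∀ z, ∫ ω', f z (D 0 ω') ∂μ = ∫ d, f z d ∂ν := fun z => by
    rw [hν, (hident t).map_eq, integral_map (hD 0).aemeasurable
      (hfz z).aestronglyMeasurable]
  simp only [hlaw]
  have hg : Measurable fun z => ∫ d, f z d ∂ν :=
    (hf.stronglyMeasurable.integral_prod_right').measurable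
  -- Laws of pairs consisting of a known quantity and the current demand.
  have hpair : Integrable (Function.uncurry f) ((μ.map Z).prod ν) := by
    rw [← (indepFun_iff_map_prod_eq_prod_map_map hZ'.aemeasurable (hD t).aemeasurable).1
      (indepFun_demand hD hindep t hZ)]
    exact (integrable_map_measure hf.aestronglyMeasurable
      (hZ'.prodMk (hD t)).aemeasurable).2 hint
  have hgint : Integrable (fun ω => ∫ d, f (Z ω) d ∂ν) μ :=
    (integrable_map_measure hg.aestronglyMeasurable hZ'.aemeasurable).1 hpair.integral_prod_left
  refine (ae_eq_condExp_of_forall_setIntegral_eq hle hint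
    (fun s _ _ => hgint.integrableOn) (fun s hs _ => ?_) ?_).symm
  · have hs' := hle s hs
    let W : Ω → ℝ × E := fun ω => (s.indicator 1 ω, Z ω)
    have hs1 : Measurable[history D t] (s.indicator (1 : Ω → ℝ)) :=
      Measurable.indicator measurable_const hs
    have hW : Measurable[history D t] W := hs1.prodMk hZ
    have hW' : Measurable W := hW.mono hle le_rfl
    let F : (ℝ × E) × ℝ → ℝ := fun q => q.1.1 * f q.1.2 q.2
    have hF : Measurable F :=
      (measurable_fst.comp measurable_fst).mul
        (hf.comp ((measurable_snd.comp measurable_fst).prodMk measurable_snd))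
    have hFi : ∀ (k : Ω → ℝ) (ω : Ω),
        s.indicator 1 ω * k ω = s.indicator k ω := fun k ω => by
      by_cases h : ω ∈ s <;> simp [h]
    have hFint : Integrable (fun ω => F (W ω, D t ω)) μ := by
      have : (fun ω => F (W ω, D t ω)) = s.indicator fun ω => f (Z ω) (D t ω) :=
        funext fun ω => hFi (fun ω => f (Z ω) (D t ω)) ω
      rw [this]
      exact hint.indicator hs'
    have hprod := (indepFun_iff_map_prod_eq_prod_map_map hW'.aemeasurable (hD t).aemeasurable).1
      (indepFun_demand hD hindep t hW)
    have hFint' : Integrable F ((μ.map W).prod ν) := by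
      rw [← hprod]
      exact (integrable_map_measure hF.aestronglyMeasurable
        (hW'.prodMk (hD t)).aemeasurable).2 hFint
    have h1 : ∫ ω, F (W ω, D t ω) ∂μ = ∫ ω, ∫ d, F (W ω, d) ∂ν ∂μ := by
      rw [← integral_map (φ := fun ω => (W ω, D t ω)) (hW'.prodMk (hD t)).aemeasurable
        hF.aestronglyMeasurable, hprod, integral_prod _ hFint',
        integral_map hW'.aemeasurable]
      exact (hF.stronglyMeasurable.integral_prod_right').aestronglyMeasurable
    rw [← integral_indicator hs', ← integral_indicator hs']
    have h2 : ∀ ω, ∫ d, F (W ω, d) ∂ν = s.indicator (fun ω => ∫ d, f (Z ω) d ∂ν) ω := fun ω => by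
      rw [← hFi, ← integral_const_mul]
    have h3 : ∀ ω, F (W ω, D t ω) = s.indicator (fun ω => f (Z ω) (D t ω)) ω := fun ω =>
      hFi (fun ω => f (Z ω) (D t ω)) ω
    simp only [h2, h3] at h1
    exact h1.symm
  · exact ((hg.comp hZ).stronglyMeasurable).aestronglyMeasurable

/-- The expectation of a nonnegative function of a quantity known in period `t` and of the demand
of the `n` periods from `t` on is at least its infimum over all frozen values. -/
theorem le_lintegral_blockDemand [IsProbabilityMeasure μ] (hD : ∀ t, Measurable (D t))
    (hindep : iIndepFun D μ) (hident : ∀ t, IdentDistrib (D t) (D 0) μ μ) (n t : ℕ)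
    {A : Ω → ℝ} (hA : Measurable[history D t] A) {f : ℝ → ℝ → ℝ≥0∞}
    (hf : Measurable (Function.uncurry f)) {c : ℝ≥0∞}
    (hc : ∀ a, c ≤ ∫⁻ ω, f a (blockDemand D n 0 ω) ∂μ) :
    c ≤ ∫⁻ ω, f (A ω) (blockDemand D n t ω) ∂μ := by
  have hA' : Measurable A := hA.mono (history_le hD t) le_rfl
  have hB := measurable_blockDemand hD n t
  have hB0 := measurable_blockDemand hD n 0
  have hprod := (indepFun_iff_map_prod_eq_prod_map_map hA'.aemeasurable hB.aemeasurable).1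
      (indepFun_blockDemand hD hindep n t hA)
  have : IsProbabilityMeasure (μ.map A) := Measure.isProbabilityMeasure_map hA'.aemeasurable
  calc c = ∫⁻ _, c ∂(μ.map A) := by simp
    _ ≤ ∫⁻ a, ∫⁻ x, f a x ∂(μ.map (blockDemand D n t)) ∂(μ.map A) := by
        refine lintegral_mono fun a => ?_
        rw [(identDistrib_blockDemand hindep hident n t).map_eq,
          lintegral_map hf.of_uncurry_left hB0]
        exact hc a
    _ = ∫⁻ ω, f (A ω) (blockDemand D n t ω) ∂μ := by
        have h := lintegral_map (μ := μ) hf (hA'.prodMk hB)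
        rw [hprod, lintegral_prod _ hf.aemeasurable] at h
        exact h

end Demand

end DualSourcing

/-! ### The newsvendor problem with large backlog cost -/

namespace DualSourcing

noncomputable section

/-- Holding and backlog cost of a period that ends with net inventory `x`. -/
def periodCost (h p x : ℝ) : ℝ := h * max x 0 + p * max (-x) 0

theorem periodCost_nonneg {h p : ℝ} (hh : 0 ≤ h) (hp : 0 ≤ p) (x : ℝ) : 0 ≤ periodCost h p x :=
  add_nonneg (mul_nonneg hh (le_max_right _ _)) (mul_nonneg hp (le_max_right _ _))

theorem periodCost_eq (h p x : ℝ) : periodCost h p x = h * x + (h + p) * max (-x) 0 := by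
  have : max x 0 = x + max (-x) 0 := by
    rcases le_total x 0 with hx | hx
    · rw [max_eq_right hx, max_eq_left (neg_nonneg.2 hx)]; ring
    · rw [max_eq_left hx, max_eq_right (neg_nonpos.2 hx)]; ring
  rw [periodCost, this]; ring

theorem measurable_periodCost (h p : ℝ) : Measurable (periodCost h p) := by
  unfold periodCost; fun_prop

theorem periodCost_mono_right {h p q : ℝ} (hpq : p ≤ q) (x : ℝ) :
    periodCost h p x ≤ periodCost h q x :=
  add_le_add le_rfl (mul_le_mul_of_nonneg_right hpq (le_max_right _ _))

/-- An extra amount `r ≥ 0` on hand saves at most the backlog cost of `r` units. -/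
theorem periodCost_sub_le {h p : ℝ} (hh : 0 ≤ h) (hp : 0 ≤ p) (x : ℝ) {r : ℝ} (hr : 0 ≤ r) :
    periodCost h p x - p * r ≤ periodCost h p (x + r) := by
  have h1 : max (-x) 0 ≤ max (-(x + r)) 0 + r := by
    refine max_le ?_ (add_nonneg (le_max_right _ _) hr)
    linarith [le_max_left (-(x + r)) 0]
  have h2 : max x 0 ≤ max (x + r) 0 := max_le_max (by linarith) le_rfl
  have := mul_le_mul_of_nonneg_left h1 hp
  have := mul_le_mul_of_nonneg_left h2 hh
  unfold periodCost
  linarith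

theorem periodCost_add_le {h p : ℝ} (hh : 0 ≤ h) (hp : 0 ≤ p) (x r : ℝ) :
    periodCost h p (x + r) ≤ periodCost h p x + (h + p) * |r| := by
  have h1 : max (-(x + r)) 0 ≤ max (-x) 0 + |r| := by
    refine max_le ?_ (add_nonneg (le_max_right _ _) (abs_nonneg r))
    linarith [le_max_left (-x) 0, neg_abs_le r]
  have h2 : max (x + r) 0 ≤ max x 0 + |r| := by
    refine max_le ?_ (add_nonneg (le_max_right _ _) (abs_nonneg r))
    linarith [le_max_left x 0, le_abs_self r]
  have := mul_le_mul_of_nonneg_left h1 hp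
  have := mul_le_mul_of_nonneg_left h2 hh
  unfold periodCost
  linarith

section Newsvendor

variable {Ω : Type*} [MeasurableSpace Ω] (μ : Measure Ω) (X : Ω → ℝ)

/-- Expected cost of the newsvendor that faces demand `X` with stock `s`. -/
def newsvendorCost (h p s : ℝ) : ℝ := ∫ ω, periodCost h p (s - X ω) ∂μ

/-- Expected excess of `X` over the level `s`. -/
def meanExcess (s : ℝ) : ℝ := ∫ ω, max (X ω - s) 0 ∂μ

variable {μ} {X}

theorem meanExcess_nonneg (s : ℝ) : 0 ≤ meanExcess μ X s :=
  integral_nonneg fun _ => le_max_right _ _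

theorem newsvendorCost_nonneg {h p : ℝ} (hh : 0 ≤ h) (hp : 0 ≤ p) (s : ℝ) :
    0 ≤ newsvendorCost μ X h p s :=
  integral_nonneg fun _ => periodCost_nonneg hh hp _

theorem meanExcess_eq_zero {s : ℝ} (hs : ∀ᵐ ω ∂μ, X ω ≤ s) : meanExcess μ X s = 0 := by
  refine integral_eq_zero_of_ae ?_
  filter_upwards [hs] with ω hω
  exact max_eq_right (by linarith)

variable [IsProbabilityMeasure μ]

theorem integrable_excess (hX : Integrable X μ) (s : ℝ) :
    Integrable (fun ω => max (X ω - s) 0) μ :=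
  (hX.sub (integrable_const s)).pos_part

theorem integrable_periodCost (hX : Integrable X μ) (h p s : ℝ) :
    Integrable (fun ω => periodCost h p (s - X ω)) μ :=
  (((integrable_const s).sub hX).pos_part.const_mul h).add
    (((integrable_const s).sub hX).neg.pos_part.const_mul p)

theorem meanExcess_anti (hX : Integrable X μ) {s t : ℝ} (hst : s ≤ t) :
    meanExcess μ X t ≤ meanExcess μ X s :=
  integral_mono (integrable_excess hX t) (integrable_excess hX s) fun ω =>
    max_le_max (by linarith) le_rfl

theorem newsvendorCost_eq (hX : Integrable X μ) (h p s : ℝ) :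
    newsvendorCost μ X h p s = h * (s - ∫ ω, X ω ∂μ) + (h + p) * meanExcess μ X s := by
  have h1 : ∀ ω, periodCost h p (s - X ω) = h * (s - X ω) + (h + p) * max (X ω - s) 0 := by
    intro ω; rw [periodCost_eq, neg_sub]
  simp only [newsvendorCost, h1]
  have hi : Integrable (fun ω => s - X ω) μ := (integrable_const s).sub hX
  rw [integral_add (hi.const_mul h) ((integrable_excess hX s).const_mul _), integral_const_mul, integral_const_mul,
    integral_sub (integrable_const s) hX]
  simp [meanExcess]

theorem mul_meanExcess_le_newsvendorCost (hX : Integrable X μ) {h : ℝ} (hh : 0 ≤ h) (p s : ℝ) :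
    p * meanExcess μ X s ≤ newsvendorCost μ X h p s := by
  rw [meanExcess, ← integral_const_mul]
  refine integral_mono ((integrable_excess hX s).const_mul p) (integrable_periodCost hX h p s)
    fun ω => ?_
  have := mul_nonneg hh (le_max_right (s - X ω) 0)
  simp only [periodCost, neg_sub]
  linarith

theorem mul_sub_mean_le_newsvendorCost (hX : Integrable X μ) {h p : ℝ} (hhp : 0 ≤ h + p) (s : ℝ) :
    h * (s - ∫ ω, X ω ∂μ) ≤ newsvendorCost μ X h p s := by
  rw [newsvendorCost_eq hX]
  have := mul_nonneg hhp (meanExcess_nonneg (μ := μ) (X := X) s)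
  linarith

/-- If the demand is not constant, then no stock level makes the newsvendor cost small. -/
theorem exists_pos_le_newsvendorCost (hX : Integrable X μ) (hc : ¬ ∃ c : ℝ, ∀ᵐ ω ∂μ, X ω = c)
    {h p : ℝ} (hh : 0 < h) (hp : 0 < p) :
    ∃ κ > 0, ∀ s, κ ≤ newsvendorCost μ X h p s := by
  set m := ∫ ω, X ω ∂μ with hm
  have hint : ∀ s : ℝ, Integrable (fun ω => |s - X ω|) μ := fun s =>
    ((integrable_const s).sub hX).abs
  have hpos : 0 < ∫ ω, |m - X ω| ∂μ := by
    refine lt_of_le_of_ne (integral_nonneg fun _ => abs_nonneg _) fun h0 => hc ⟨m, ?_⟩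
    have := (integral_eq_zero_iff_of_nonneg (fun ω => abs_nonneg _) (hint m)).1 h0.symm
    filter_upwards [this] with ω hω
    have := abs_eq_zero.1 hω
    linarith
  have hmin : 0 < min h p := lt_min hh hp
  refine ⟨min h p * ((∫ ω, |m - X ω| ∂μ) / 2), by positivity, fun s => ?_⟩
  -- The mean is the constant closest to `X` in mean, up to the factor 2.
  have h1 : |s - m| ≤ ∫ ω, |s - X ω| ∂μ := by
    have : s - m = ∫ ω, (s - X ω) ∂μ := by
      rw [integral_sub (integrable_const s) hX]; simp [hm]
    rw [this]
    exact abs_integral_le_integral_abs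
  have h2 : ∫ ω, |m - X ω| ∂μ ≤ ∫ ω, (|s - X ω| + |s - m|) ∂μ := by
    refine integral_mono (hint m) ((hint s).add (integrable_const _)) fun ω => ?_
    have := abs_sub_le m s (X ω)
    rw [abs_sub_comm m s] at this
    simp only; linarith
  rw [integral_add (hint s) (integrable_const _)] at h2
  simp only [integral_const, probReal_univ, smul_eq_mul, one_mul] at h2
  have h3 : min h p * ∫ ω, |s - X ω| ∂μ ≤ newsvendorCost μ X h p s := by
    rw [← integral_const_mul]
    refine integral_mono ((hint s).const_mul _) (integrable_periodCost hX h p s) fun ω => ?_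
    have e : |s - X ω| = max (s - X ω) 0 + max (-(s - X ω)) 0 := by
      rcases le_total (s - X ω) 0 with hx | hx
      · rw [abs_of_nonpos hx, max_eq_right hx, max_eq_left (neg_nonneg.2 hx), zero_add]
      · rw [abs_of_nonneg hx, max_eq_left hx, max_eq_right (neg_nonpos.2 hx), add_zero]
    have a1 := mul_le_mul_of_nonneg_right (min_le_left h p) (le_max_right (s - X ω) 0)
    have a2 := mul_le_mul_of_nonneg_right (min_le_right h p) (le_max_right (-(s - X ω)) 0)
    simp only [e, periodCost, mul_add]
    exact add_le_add a1 a2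
  refine le_trans (mul_le_mul_of_nonneg_left ?_ hmin.le) h3
  linarith

theorem meanExcess_pos (hX : Integrable X μ) {s : ℝ} (hs : ¬ ∀ᵐ ω ∂μ, X ω ≤ s) :
    0 < meanExcess μ X s := by
  refine lt_of_le_of_ne (meanExcess_nonneg s) fun h0 => hs ?_
  have := (integral_eq_zero_iff_of_nonneg (fun ω => le_max_right _ _)
    (integrable_excess hX s)).1 h0.symm
  filter_upwards [this] with ω hω
  have h1 : max (X ω - s) 0 = 0 := hω
  linarith [le_max_left (X ω - s) 0]

theorem tendsto_meanExcess (hX : Integrable X μ) :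
    Tendsto (meanExcess μ X) atTop (𝓝 0) := by
  have h0 : (0 : ℝ) = ∫ _, (0 : ℝ) ∂μ := by simp
  rw [h0]
  refine tendsto_integral_filter_of_dominated_convergence (fun ω => |X ω|)
    (Eventually.of_forall fun s => (integrable_excess hX s).aestronglyMeasurable) ?_ hX.abs ?_
  · filter_upwards [eventually_ge_atTop (0 : ℝ)] with s hs
    refine Eventually.of_forall fun ω => ?_
    rw [Real.norm_of_nonneg (le_max_right _ _)]
    exact max_le (by linarith [le_abs_self (X ω)]) (abs_nonneg _)
  · refine Eventually.of_forall fun ω => tendsto_const_nhds.congr' ?_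
    filter_upwards [eventually_ge_atTop (X ω)] with s hs
    exact (max_eq_right (by linarith)).symm

theorem meanExcess_eq_measureReal_mul (hXm : Measurable X) (d : ℝ)
    (hd : μ {ω | d < X ω} ≠ 0) :
    meanExcess μ X d
      = μ.real {ω | d < X ω} * ∫ ω, (X ω - d) ∂(μ[|{ω | d < X ω}]) := by
  have hs : MeasurableSet {ω | d < X ω} := measurableSet_lt measurable_const hXm
  have h1 : meanExcess μ X d = ∫ ω in {ω | d < X ω}, (X ω - d) ∂μ := by
    rw [meanExcess, ← integral_indicator hs]
    refine integral_congr_ae (Eventually.of_forall fun ω => ?_)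
    by_cases h : d < X ω
    · simp only [Set.indicator, Set.mem_ofPred_eq, h, if_true]
      exact max_eq_left (by linarith)
    · simp only [Set.indicator, Set.mem_ofPred_eq, h, if_false]
      exact max_eq_right (by linarith)
  have hne : μ.real {ω | d < X ω} ≠ 0 := by
    rw [Measure.real, Ne, ENNReal.toReal_eq_zero_iff]
    simp [hd]
  rw [h1, ProbabilityTheory.cond, integral_smul_measure, ENNReal.toReal_inv, smul_eq_mul,
    ← Measure.real, mul_inv_cancel_left₀ hne]

/-- Under the tail condition the expected excess is rapidly varying: raising the level by a fixed
proportion divides the expected excess by any prescribed factor, once the level is high enough. -/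
theorem eventually_mul_meanExcess_le (hX : Integrable X μ) (hXm : Measurable X)
    (hunb : ¬ IsBoundedAbove μ X)
    (htail : Tendsto (fun d : ℝ => (∫ ω, (X ω - d) ∂(μ[|{ω | d < X ω}])) / d) atTop (𝓝 0))
    {ε K : ℝ} (hε : 0 < ε) (hK : 0 < K) :
    ∀ᶠ s in atTop, K * meanExcess μ X ((1 + ε) * s) ≤ meanExcess μ X s := by
  set δ := ε / ((1 + ε) * K) with hδ
  have hδpos : 0 < δ := by positivity
  have h1 : ∀ᶠ d : ℝ in atTop, meanExcess μ X d ≤ δ * d * μ.real {ω | d < X ω} := by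
    filter_upwards [htail.eventually (gt_mem_nhds hδpos), eventually_gt_atTop 0] with d hd hd0
    have hne : μ {ω | d < X ω} ≠ 0 := fun h0 => hunb ⟨d, by
      rw [ae_iff]; simpa using h0⟩
    rw [meanExcess_eq_measureReal_mul hXm d hne, mul_comm]
    exact mul_le_mul_of_nonneg_right ((div_lt_iff₀ hd0).1 hd).le measureReal_nonneg
  have hmap : Tendsto (fun s : ℝ => (1 + ε) * s) atTop atTop :=
    tendsto_id.const_mul_atTop (by positivity)
  filter_upwards [hmap.eventually h1, eventually_gt_atTop 0] with s hs hs0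
  set d := (1 + ε) * s with hd
  have hsm : MeasurableSet {ω | d < X ω} := measurableSet_lt measurable_const hXm
  -- The expected excess falls by at least `(d - s) * P(X > d)` between the levels `s` and `d`.
  have h2 : meanExcess μ X d + ε * s * μ.real {ω | d < X ω} ≤ meanExcess μ X s := by
    have e : ε * s * μ.real {ω | d < X ω}
        = ∫ ω, {ω | d < X ω}.indicator (fun _ => ε * s) ω ∂μ := by
      rw [integral_indicator_const _ hsm, smul_eq_mul, mul_comm]
    have hi : Integrable ({ω | d < X ω}.indicator fun _ => ε * s) μ :=
      (integrable_const _).indicator hsm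
    rw [e, meanExcess, ← integral_add (integrable_excess hX d) hi]
    refine integral_mono ((integrable_excess hX d).add hi) (integrable_excess hX s) fun ω => ?_
    have hes : 0 < ε * s := mul_pos hε hs0
    by_cases hω : d < X ω
    · simp only [Set.indicator, Set.mem_ofPred_eq, hω, if_true]
      rw [max_eq_left (by linarith), max_eq_left (by linarith)]
      linarith
    · simp only [Set.indicator, Set.mem_ofPred_eq, hω, if_false, add_zero]
      exact max_le_max (by linarith) le_rfl
  have h3 : K * (δ * d * μ.real {ω | d < X ω}) = ε * s * μ.real {ω | d < X ω} := by
    rw [hδ, hd]; field_simp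
  have h4 := mul_le_mul_of_nonneg_left hs hK.le
  linarith [meanExcess_nonneg (μ := μ) (X := X) d]

/-- For bounded demand, stocking the essential supremum is asymptotically optimal. -/
theorem eventually_newsvendorCost_le_of_bounded (hX : Integrable X μ)
    (hc : ¬ ∃ c : ℝ, ∀ᵐ ω ∂μ, X ω = c) (hb : IsBoundedAbove μ X)
    {h p c ε : ℝ} (hh : 0 < h) (hcpos : 0 < c) (hε : 0 < ε) :
    ∀ᶠ n : ℝ in atTop, ∀ s, ∃ s', ∫ ω, X ω ∂μ ≤ s' ∧
      newsvendorCost μ X h (p * n) s' ≤ (1 + ε) * newsvendorCost μ X h (c * n) s := by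
  set m := ∫ ω, X ω ∂μ with hm
  obtain ⟨B, hB⟩ := hb
  set M := essSup X μ with hM
  have hXM : ∀ᵐ ω ∂μ, X ω ≤ M := ae_le_essSup ⟨B, by simpa using hB⟩
  have hlow : ∀ s, (∀ᵐ ω ∂μ, X ω ≤ s) → m ≤ s := fun s hs => by
    have := integral_mono_ae hX (integrable_const s) hs
    simpa using this
  have hbdd : BddBelow {a | ∀ᵐ ω ∂μ, X ω ≤ a} := ⟨m, fun s hs => hlow s hs⟩
  have hMle : ∀ s, (∀ᵐ ω ∂μ, X ω ≤ s) → M ≤ s := fun s hs => by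
    have : M = sInf {a | ∀ᵐ ω ∂μ, X ω ≤ a} := by
      rw [hM, essSup, limsup_eq]
    rw [this]
    exact csInf_le hbdd hs
  have hmM : m < M := by
    refine lt_of_le_of_ne (hlow M hXM) fun heq => hc ⟨M, ?_⟩
    have h0 : ∫ ω, (M - X ω) ∂μ = 0 := by
      rw [integral_sub (integrable_const M) hX]
      simp only [integral_const, probReal_univ, smul_eq_mul, one_mul]
      linarith
    have := (integral_eq_zero_iff_of_nonneg_ae (hXM.mono fun ω hω => sub_nonneg.2 hω)
      ((integrable_const M).sub hX)).1 h0
    filter_upwards [this] with ω hω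
    have : M - X ω = 0 := hω
    linarith
  set δ := ε / (1 + ε) * (M - m) with hδ
  have hδpos : 0 < δ := mul_pos (by positivity) (by linarith)
  have hφ : 0 < meanExcess μ X (M - δ) :=
    meanExcess_pos hX fun hs => absurd (hMle _ hs) (by linarith)
  have hn : ∀ᶠ n : ℝ in atTop, h * (M - m) ≤ c * n * meanExcess μ X (M - δ) :=
    ((tendsto_id.const_mul_atTop hcpos).atTop_mul_const hφ).eventually_ge_atTop _
  filter_upwards [hn, eventually_ge_atTop 0] with n hn hn0 s
  refine ⟨M, hmM.le, ?_⟩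
  have hcn : 0 ≤ c * n := by positivity
  rw [newsvendorCost_eq hX h (p * n) M, meanExcess_eq_zero hXM, mul_zero, add_zero]
  have hpos : 0 ≤ h * (M - m) := mul_nonneg hh.le (by linarith)
  rcases le_total s (M - δ) with hs | hs
  · have h1 := mul_meanExcess_le_newsvendorCost hX hh.le (c * n) s
    have h2 := mul_le_mul_of_nonneg_left (meanExcess_anti hX hs) hcn
    have h3 : h * (M - m) ≤ newsvendorCost μ X h (c * n) s := by linarith
    nlinarith
  · have h1 := mul_sub_mean_le_newsvendorCost hX (h := h) (p := c * n) (by positivity) s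
    have h2 : h * (M - δ - m) ≤ h * (s - m) := mul_le_mul_of_nonneg_left (by linarith) hh.le
    have h3 : (1 + ε) * (h * (M - δ - m)) = h * (M - m) := by
      rw [hδ]; field_simp; ring
    rw [← h3]
    exact mul_le_mul_of_nonneg_left (by linarith) (by positivity)

/-- For unbounded demand with the tail condition, raising a high stock level by a small proportion
makes up for any fixed change of the backlog cost rate. -/
theorem eventually_newsvendorCost_le_of_unbounded (hX : Integrable X μ) (hXm : Measurable X)
    (hmpos : 0 < ∫ ω, X ω ∂μ) (hunb : ¬ IsBoundedAbove μ X)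
    (htail : Tendsto (fun d : ℝ => (∫ ω, (X ω - d) ∂(μ[|{ω | d < X ω}])) / d) atTop (𝓝 0))
    {h p c ε : ℝ} (hh : 0 < h) (hp : 0 < p) (hcpos : 0 < c) (hε : 0 < ε) :
    ∀ᶠ n : ℝ in atTop, ∀ s, ∃ s', ∫ ω, X ω ∂μ ≤ s' ∧
      newsvendorCost μ X h (p * n) s' ≤ (1 + ε) * newsvendorCost μ X h (c * n) s := by
  set m := ∫ ω, X ω ∂μ with hm
  have hK : 0 < 1 + p / c := by positivity
  obtain ⟨s₁, hs₁⟩ := eventually_atTop.1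
    (eventually_mul_meanExcess_le hX hXm hunb htail (half_pos hε) hK)
  set s₀ := max s₁ (2 * m) with hs₀
  have hφ : ∀ s, 0 < meanExcess μ X s := fun s => meanExcess_pos hX fun hs => hunb ⟨s, hs⟩
  have hhigh : ∀ n : ℝ, 0 ≤ n → ∀ s, s₀ ≤ s →
      m ≤ (1 + ε / 2) * s ∧ newsvendorCost μ X h (p * n) ((1 + ε / 2) * s)
        ≤ (1 + ε) * newsvendorCost μ X h (c * n) s := by
    intro n hn s hs
    have hs1 : s₁ ≤ s := le_trans (le_max_left _ _) hs
    have hs2 : 2 * m ≤ s := le_trans (le_max_right _ _) hs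
    have hspos : 0 < s := by linarith
    have hεs : 0 < ε * s := mul_pos hε hspos
    refine ⟨by nlinarith, ?_⟩
    have h1 := hs₁ s hs1
    have hcn : 0 ≤ h + c * n := by positivity
    have h2 : (h + p * n) * meanExcess μ X ((1 + ε / 2) * s)
        ≤ (h + c * n) * meanExcess μ X s := by
      have e : (h + c * n) * (1 + p / c) = (h + p * n) + (h * (p / c) + c * n) := by
        field_simp; ring
      have h3 := mul_le_mul_of_nonneg_left h1 hcn
      rw [← mul_assoc, e] at h3
      have h4 : 0 ≤ (h * (p / c) + c * n) * meanExcess μ X ((1 + ε / 2) * s) :=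
        mul_nonneg (by positivity) (hφ _).le
      linarith
    have h5 := mul_sub_mean_le_newsvendorCost hX (h := h) (p := c * n) (by positivity) s
    have h6 : newsvendorCost μ X h (p * n) ((1 + ε / 2) * s)
        ≤ newsvendorCost μ X h (c * n) s + ε * (h * (s / 2)) := by
      rw [newsvendorCost_eq hX, newsvendorCost_eq hX]
      linarith
    have h7 : h * (s / 2) ≤ newsvendorCost μ X h (c * n) s :=
      le_trans (mul_le_mul_of_nonneg_left (by linarith) hh.le) h5
    have h8 := mul_le_mul_of_nonneg_left h7 hε.le
    linarith
  -- A fixed level above `s₀` beats all levels below `s₀` once the backlog cost is high.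
  obtain ⟨s₂, hs₂, hs₂'⟩ := ((tendsto_meanExcess hX).eventually
    (gt_mem_nhds (half_pos (hφ s₀)))).and (eventually_ge_atTop s₀) |>.exists
  have hn : ∀ᶠ n : ℝ in atTop,
      h * (s₂ - m) + h * meanExcess μ X s₂ ≤ c * n * (meanExcess μ X s₀ / 2) :=
    ((tendsto_id.const_mul_atTop hcpos).atTop_mul_const (half_pos (hφ s₀))).eventually_ge_atTop _
  filter_upwards [hn, eventually_ge_atTop 0] with n hn hn0 s
  rcases le_total s₀ s with hs | hs
  · exact ⟨_, hhigh n hn0 s hs⟩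
  · refine ⟨_, (hhigh n hn0 s₂ hs₂').1, (hhigh n hn0 s₂ hs₂').2.trans ?_⟩
    refine mul_le_mul_of_nonneg_left ?_ (by positivity)
    have hcn : 0 ≤ c * n := by positivity
    have h1 := mul_meanExcess_le_newsvendorCost hX hh.le (c * n) s
    have h2 := mul_le_mul_of_nonneg_left (meanExcess_anti hX hs) hcn
    have h3 := mul_le_mul_of_nonneg_left hs₂.le hcn
    rw [newsvendorCost_eq hX h (c * n) s₂]
    linarith

theorem DemandCondition.eventually_newsvendorCost_le (hd : DemandCondition μ X)
    (hXm : Measurable X) (hc : ¬ ∃ c : ℝ, ∀ᵐ ω ∂μ, X ω = c)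
    {h p c ε : ℝ} (hh : 0 < h) (hp : 0 < p) (hcpos : 0 < c) (hε : 0 < ε) :
    ∀ᶠ n : ℝ in atTop, ∀ s, ∃ s', ∫ ω, X ω ∂μ ≤ s' ∧
      newsvendorCost μ X h (p * n) s' ≤ (1 + ε) * newsvendorCost μ X h (c * n) s := by
  rcases hd.tail with hb | ⟨hu, ht⟩
  · exact eventually_newsvendorCost_le_of_bounded hd.integrable hc hb hh hcpos hε
  · exact eventually_newsvendorCost_le_of_unbounded hd.integrable hXm hd.mean_pos hu ht
      hh hp hcpos hε

end Newsvendor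

end

end DualSourcing

/-! ### Lower bound for all policies -/

namespace DualSourcing

noncomputable section

namespace Policy

variable {Ω : Type*} {D : ℕ → Ω → ℝ}

/-- Inventory position after the orders of period `t`: everything ordered in the periods `0, …, t`
from either supplier, minus the demands of the periods before `t`. -/
def orderPosition (π : Policy D) (t : ℕ) (ω : Ω) : ℝ :=
  ∑ i ∈ Finset.range (t + 1), π.expedited i ω + ∑ i ∈ Finset.range (t + 1), π.regular i ω
    - ∑ i ∈ Finset.range t, D i ω

theorem measurable_orderPosition (π : Policy D) (t : ℕ) :
    Measurable[history D t] (π.orderPosition t) := by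
  refine Measurable.sub (Measurable.add ?_ ?_) ?_
  · exact Finset.measurable_fun_sum _ fun i hi => (π.expedited_adapted i).mono
      (history_mono D (Nat.lt_succ_iff.1 (Finset.mem_range.1 hi))) le_rfl
  · exact Finset.measurable_fun_sum _ fun i hi => (π.regular_adapted i).mono
      (history_mono D (Nat.lt_succ_iff.1 (Finset.mem_range.1 hi))) le_rfl
  · exact Finset.measurable_fun_sum _ fun i hi => measurable_demand_history (Finset.mem_range.1 hi)

theorem cost_eq (π : Policy D) (p h ce : ℝ) (le lr t : ℕ) (ω : Ω) :
    π.cost p h ce le lr t ω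
      = ce * π.expedited t ω + periodCost h p (π.netInventory le lr t ω - D t ω) := by
  simp only [cost, periodCost, neg_sub]; ring

/-- All orders that have arrived by period `t + lr` were placed by period `t`, except for the
expedited orders of the periods `t + 1, …, t + (lr - le)`. -/
theorem netInventory_sub_demand (π : Policy D) {le lr : ℕ} (hl : le < lr) (t : ℕ) (ω : Ω) :
    π.netInventory le lr (t + lr) ω - D (t + lr) ω
      = π.orderPosition t ω - blockDemand D (lr + 1) t ω
        + ∑ i ∈ Finset.range (lr - le), π.expedited (t + 1 + i) ω := by
  have h1 : t + lr + 1 - le = t + 1 + (lr - le) := by omega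
  have h2 : t + lr + 1 - lr = t + 1 := by omega
  rw [netInventory, h1, h2, Finset.sum_range_add (fun i => π.expedited i ω),
    sum_range_add_eq D lr t ω, blockDemand_succ, orderPosition]
  ring

/-- If expediting a unit costs at least as much as backlogging it for `lr - le` periods, then
period `t + lr` may be charged as if only the orders placed up to period `t` had arrived. The
expedited orders left out are paid for by their own cost: an expedited order is left out in at
most `lr - le` periods, and in each of them it saves at most its backlog cost. -/
theorem sum_periodCost_le_sum_cost (π : Policy D) {le lr : ℕ} (hl : le < lr) {p p' h ce : ℝ}
    (hp' : 0 ≤ p') (hpp : p' ≤ p) (hh : 0 ≤ h) (hce : p' * ((lr - le : ℕ) : ℝ) ≤ ce)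
    (T : ℕ) (ω : Ω) :
    ∑ t ∈ Finset.range (T + 1 - lr),
        periodCost h p' (π.orderPosition t ω - blockDemand D (lr + 1) t ω)
      ≤ ∑ t ∈ Finset.Icc 1 T, π.cost p h ce le lr t ω := by
  set l := lr - le with hldef
  set c : ℕ → ℝ := fun t => periodCost h p (π.netInventory le lr t ω - D t ω) with hc
  have hc0 : ∀ t, 0 ≤ c t := fun t => periodCost_nonneg hh (hp'.trans hpp) _
  have he : ∀ t, 0 ≤ π.expedited t ω := fun t => π.expedited_nonneg t ω
  have h1 : ∑ t ∈ Finset.Icc 1 T, π.cost p h ce le lr t ω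
      = ce * ∑ t ∈ Finset.Icc 1 T, π.expedited t ω + ∑ t ∈ Finset.Icc 1 T, c t := by
    rw [Finset.mul_sum, ← Finset.sum_add_distrib]
    exact Finset.sum_congr rfl fun t _ => π.cost_eq p h ce le lr t ω
  have h2 : ∑ t ∈ Finset.range (T + 1 - lr), c (t + lr) ≤ ∑ t ∈ Finset.Icc 1 T, c t := by
    have hinj : Set.InjOn (fun t => t + lr) (Finset.range (T + 1 - lr)) :=
      fun a _ b _ hab => Nat.add_right_cancel hab
    rw [← Finset.sum_image (f := c) hinj]
    refine Finset.sum_le_sum_of_subset_of_nonneg (fun i hi => ?_) fun i _ _ => hc0 i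
    obtain ⟨a, ha, rfl⟩ := Finset.mem_image.1 hi
    have := Finset.mem_range.1 ha
    simp only [Finset.mem_Icc]
    omega
  have h3 : ∀ t, periodCost h p' (π.orderPosition t ω - blockDemand D (lr + 1) t ω)
      ≤ c (t + lr) + p' * ∑ i ∈ Finset.range l, π.expedited (t + 1 + i) ω := fun t => by
    have := periodCost_sub_le hh hp' (π.orderPosition t ω - blockDemand D (lr + 1) t ω)
      (Finset.sum_nonneg fun i (_ : i ∈ Finset.range l) => he (t + 1 + i))
    rw [← π.netInventory_sub_demand hl] at this
    have h4 := periodCost_mono_right (h := h) hpp (π.netInventory le lr (t + lr) ω - D (t + lr) ω)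
    simp only [hc]
    linarith
  -- Every expedited order occurs in at most `l` of the sums over `l` consecutive periods.
  have h5 : ∑ t ∈ Finset.range (T + 1 - lr), ∑ i ∈ Finset.range l, π.expedited (t + 1 + i) ω
      ≤ (l : ℝ) * ∑ t ∈ Finset.Icc 1 T, π.expedited t ω := by
    rw [Finset.sum_comm]
    have : ∀ i ∈ Finset.range l, ∑ t ∈ Finset.range (T + 1 - lr), π.expedited (t + 1 + i) ω
        ≤ ∑ t ∈ Finset.Icc 1 T, π.expedited t ω := fun i hi => by
      have hinj : Set.InjOn (fun t => t + 1 + i) (Finset.range (T + 1 - lr)) :=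
        fun a _ b _ hab => by
          have : a + 1 + i = b + 1 + i := hab
          omega
      rw [← Finset.sum_image (f := fun t => π.expedited t ω) hinj]
      refine Finset.sum_le_sum_of_subset_of_nonneg (fun j hj => ?_) fun j _ _ => he j
      obtain ⟨a, ha, rfl⟩ := Finset.mem_image.1 hj
      have := Finset.mem_range.1 ha
      have := Finset.mem_range.1 hi
      simp only [Finset.mem_Icc]
      omega
    refine (Finset.sum_le_sum this).trans ?_
    simp
  have h6 := Finset.sum_le_sum fun t (_ : t ∈ Finset.range (T + 1 - lr)) => h3 t
  rw [Finset.sum_add_distrib, ← Finset.mul_sum] at h6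
  have h7 := mul_le_mul_of_nonneg_left h5 hp'
  have h8 := mul_le_mul_of_nonneg_right hce
    (Finset.sum_nonneg fun t (_ : t ∈ Finset.Icc 1 T) => he t)
  rw [h1]
  linarith

end Policy

/-- Costs of `c` in all but `k - 1` periods still average to `c` in the long run. -/
theorem tendsto_sub_mul_div (k : ℕ) {c : ℝ≥0∞} (hc : c ≠ ∞) :
    Tendsto (fun T : ℕ => ((T + 1 - k : ℕ) : ℝ≥0∞) * c / (T : ℝ≥0∞)) atTop (𝓝 c) := by
  have h1 : Tendsto (fun T : ℕ => ((T + 1 - k : ℕ) : ℝ≥0∞) / (T : ℝ≥0∞)) atTop (𝓝 1) := by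
    have hr : Tendsto (fun T : ℕ => 1 + (1 - k : ℝ) / (T : ℝ)) atTop (𝓝 1) := by
      simpa using (tendsto_const_div_atTop_nhds_zero_nat (1 - k : ℝ)).const_add 1
    have h2 := ENNReal.tendsto_ofReal hr
    rw [ENNReal.ofReal_one] at h2
    refine h2.congr' ?_
    filter_upwards [eventually_ge_atTop (k + 1)] with T hT
    have hT0 : (0 : ℝ) < T := by exact_mod_cast (by omega : 0 < T)
    have e : 1 + (1 - k : ℝ) / (T : ℝ) = ((T + 1 - k : ℕ) : ℝ) / T := by
      rw [Nat.cast_sub (by omega)]; push_cast; field_simp; ring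
    rw [e, ENNReal.ofReal_div_of_pos hT0, ENNReal.ofReal_natCast, ENNReal.ofReal_natCast]
  have h2 := ENNReal.Tendsto.mul_const (b := c) h1 (Or.inr hc)
  rw [one_mul] at h2
  refine h2.congr fun T => ?_
  rw [div_eq_mul_inv, div_eq_mul_inv, mul_right_comm]

section LowerBound

variable {Ω : Type*} [MeasurableSpace Ω] {μ : Measure Ω} [IsProbabilityMeasure μ] {D : ℕ → Ω → ℝ}

/-- Every policy costs at least as much as the best newsvendor whose demand is that of `lr + 1`
periods and whose backlog cost makes expediting useless. -/
theorem le_optimalCost (hD : ∀ t, Measurable (D t)) (hindep : iIndepFun D μ)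
    (hident : ∀ t, IdentDistrib (D t) (D 0) μ μ) {le lr : ℕ} (hl : le < lr)
    (hint : Integrable (blockDemand D (lr + 1) 0) μ) {p p' h ce : ℝ} (hp' : 0 ≤ p') (hpp : p' ≤ p)
    (hh : 0 ≤ h) (hce : p' * ((lr - le : ℕ) : ℝ) ≤ ce) {c : ℝ}
    (hc : ∀ s, c ≤ newsvendorCost μ (blockDemand D (lr + 1) 0) h p' s) :
    ENNReal.ofReal c ≤ optimalCost μ D p h ce le lr := by
  refine le_iInf fun π => ?_
  have hce0 : 0 ≤ ce := le_trans (by positivity) hce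
  have hper : ∀ t, ENNReal.ofReal c ≤ ∫⁻ ω, ENNReal.ofReal
      (periodCost h p' (π.orderPosition t ω - blockDemand D (lr + 1) t ω)) ∂μ := fun t => by
    refine le_lintegral_blockDemand hD hindep hident (lr + 1) t (π.measurable_orderPosition t)
      (f := fun a x => ENNReal.ofReal (periodCost h p' (a - x))) ?_ fun a => ?_
    · exact ((measurable_periodCost h p').comp (measurable_fst.sub measurable_snd)).ennreal_ofReal
    · rw [← ofReal_integral_eq_lintegral_ofReal (integrable_periodCost hint h p' a)
        (Eventually.of_forall fun ω => periodCost_nonneg hh hp' _)]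
      exact ENNReal.ofReal_le_ofReal (hc a)
  have hmeas : ∀ t, Measurable fun ω => ENNReal.ofReal
      (periodCost h p' (π.orderPosition t ω - blockDemand D (lr + 1) t ω)) := fun t =>
    ((measurable_periodCost h p').comp (((π.measurable_orderPosition t).mono
      (history_le hD t) le_rfl).sub (measurable_blockDemand hD _ t))).ennreal_ofReal
  have hsum : ∀ T : ℕ, ((T + 1 - lr : ℕ) : ℝ≥0∞) * ENNReal.ofReal c
      ≤ ∑ t ∈ Finset.Icc 1 T, ∫⁻ ω, ENNReal.ofReal (π.cost p h ce le lr t ω) ∂μ := fun T => by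
    have hcost0 : ∀ t ω, 0 ≤ π.cost p h ce le lr t ω := fun t ω => by
      rw [π.cost_eq]
      exact add_nonneg (mul_nonneg hce0 (π.expedited_nonneg t ω))
        (periodCost_nonneg hh (hp'.trans hpp) _)
    calc ((T + 1 - lr : ℕ) : ℝ≥0∞) * ENNReal.ofReal c
        = ∑ t ∈ Finset.range (T + 1 - lr), ENNReal.ofReal c := by simp
      _ ≤ ∑ t ∈ Finset.range (T + 1 - lr), ∫⁻ ω, ENNReal.ofReal
            (periodCost h p' (π.orderPosition t ω - blockDemand D (lr + 1) t ω)) ∂μ :=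
          Finset.sum_le_sum fun t _ => hper t
      _ = ∫⁻ ω, ∑ t ∈ Finset.range (T + 1 - lr), ENNReal.ofReal
            (periodCost h p' (π.orderPosition t ω - blockDemand D (lr + 1) t ω)) ∂μ :=
          (lintegral_finsetSum _ fun t _ => hmeas t).symm
      _ ≤ ∫⁻ ω, ∑ t ∈ Finset.Icc 1 T, ENNReal.ofReal (π.cost p h ce le lr t ω) ∂μ := by
          refine lintegral_mono fun ω => ?_
          rw [← ENNReal.ofReal_sum_of_nonneg fun t _ => periodCost_nonneg hh hp' _,
            ← ENNReal.ofReal_sum_of_nonneg fun t _ => hcost0 t ω]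
          exact ENNReal.ofReal_le_ofReal
            (π.sum_periodCost_le_sum_cost hl hp' hpp hh hce T ω)
      _ = ∑ t ∈ Finset.Icc 1 T, ∫⁻ ω, ENNReal.ofReal (π.cost p h ce le lr t ω) ∂μ := by
          refine lintegral_finsetSum _ fun t _ => Measurable.ennreal_ofReal ?_
          have hm : ∀ i, Measurable (π.expedited i) := fun i =>
            (π.expedited_adapted i).mono (history_le hD i) le_rfl
          have hm' : ∀ i, Measurable (π.regular i) := fun i =>
            (π.regular_adapted i).mono (history_le hD i) le_rfl
          unfold Policy.cost Policy.netInventory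
          fun_prop
  rw [← (tendsto_sub_mul_div lr ENNReal.ofReal_ne_top).limsup_eq]
  exact limsup_le_limsup (Eventually.of_forall fun T => ENNReal.div_le_div_right (hsum T) _)

end LowerBound

end

end DualSourcing

/-! ### Construction of PEIP policies -/

namespace DualSourcing

noncomputable section

section ProjectedPosition

variable {Ω : Type*} [MeasurableSpace Ω]

/-- Expected expedited inventory position after ordering, `k` periods ahead, under expedited
order-up-to level `S`, if that position is `y` now, the regular order `a j` enters it `j + 1`
periods from now, and the demands of the periods are independent copies of `X`. -/
def projectedPosition (μ : Measure Ω) (X : Ω → ℝ) (S : ℝ) : ℕ → ℝ → (ℕ → ℝ) → ℝ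
  | 0, y, _ => y
  | k + 1, y, a =>
    ∫ ω, projectedPosition μ X S k (max (y - X ω + a 0) S) (fun j => a (j + 1)) ∂μ

variable {μ : Measure Ω} {X : Ω → ℝ} {S : ℝ}

theorem projectedPosition_congr {k : ℕ} {y : ℝ} {a b : ℕ → ℝ} (h : ∀ j < k, a j = b j) :
    projectedPosition μ X S k y a = projectedPosition μ X S k y b := by
  induction k generalizing y a b with
  | zero => rfl
  | succ k ih =>
    simp only [projectedPosition]
    rw [h 0 (Nat.succ_pos k)]
    exact integral_congr_ae (Eventually.of_forall fun ω =>
      ih fun j hj => h (j + 1) (Nat.succ_lt_succ hj))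

theorem measurable_projectedPosition [IsProbabilityMeasure μ] (hX : Measurable X) (k : ℕ) :
    Measurable fun z : ℝ × (ℕ → ℝ) => projectedPosition μ X S k z.1 z.2 := by
  induction k with
  | zero => exact measurable_fst
  | succ k ih =>
    have h : Measurable fun q : (ℝ × (ℕ → ℝ)) × Ω =>
        projectedPosition μ X S k (max (q.1.1 - X q.2 + q.1.2 0) S) (fun j => q.1.2 (j + 1)) := by
      refine ih.comp (Measurable.prodMk ?_ (measurable_pi_lambda _ fun j => ?_))
      · have h0 : Measurable fun q : (ℝ × (ℕ → ℝ)) × Ω => q.1.2 0 :=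
          (measurable_pi_apply 0).comp (measurable_snd.comp measurable_fst)
        exact (((measurable_fst.comp measurable_fst).sub (hX.comp measurable_snd)).add
          h0).max measurable_const
      · exact (measurable_pi_apply (j + 1)).comp (measurable_snd.comp measurable_fst)
    exact (h.stronglyMeasurable.integral_prod_right').measurable

theorem measurable_projectedPosition_step [IsProbabilityMeasure μ] (hX : Measurable X) (k : ℕ)
    (y : ℝ) (a : ℕ → ℝ) :
    Measurable fun ω => projectedPosition μ X S k (max (y - X ω + a 0) S)
      (fun j => a (j + 1)) :=
  (measurable_projectedPosition hX k).comp
    (Measurable.prodMk (((measurable_const.sub hX).add measurable_const).max measurable_const)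
      measurable_const)

theorem max_sub_add_le {y d x : ℝ} (hy : S ≤ y) (hd : 0 ≤ d) (hx : 0 ≤ x) :
    max (y - d + x) S ≤ y + x :=
  max_le (by linarith) (by linarith)

variable [IsProbabilityMeasure μ]

/-- The projection lies between the order-up-to level and the position without any demand. -/
theorem projectedPosition_mem_Icc (hX : Measurable X) (hX0 : ∀ ω, 0 ≤ X ω) (k : ℕ) {y : ℝ}
    {a : ℕ → ℝ} (hy : S ≤ y) (ha : ∀ j, 0 ≤ a j) :
    projectedPosition μ X S k y a ∈ Set.Icc S (y + ∑ j ∈ Finset.range k, a j) := by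
  induction k generalizing y a with
  | zero => simpa [projectedPosition] using hy
  | succ k ih =>
    have hb : ∀ ω, projectedPosition μ X S k (max (y - X ω + a 0) S) (fun j => a (j + 1))
        ∈ Set.Icc S (y + ∑ j ∈ Finset.range (k + 1), a j) := fun ω => by
      obtain ⟨h1, h2⟩ := ih (le_max_right (y - X ω + a 0) S) fun j => ha (j + 1)
      refine ⟨h1, h2.trans ?_⟩
      rw [Finset.sum_range_succ']
      linarith [max_sub_add_le hy (hX0 ω) (ha 0)]
    have hint : Integrable (fun ω => projectedPosition μ X S k (max (y - X ω + a 0) S)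
        (fun j => a (j + 1))) μ :=
      Integrable.of_mem_Icc _ _ (measurable_projectedPosition_step hX k y a).aemeasurable
        (Eventually.of_forall hb)
    have h1 := integral_mono (integrable_const S) hint fun ω => (hb ω).1
    have h2 := integral_mono hint (integrable_const _) fun ω => (hb ω).2
    simp only [integral_const, probReal_univ, smul_eq_mul, one_mul] at h1 h2
    exact ⟨h1, h2⟩

theorem integrable_projectedPosition_step (hX : Measurable X) (hX0 : ∀ ω, 0 ≤ X ω) (k : ℕ)
    {y : ℝ} {a : ℕ → ℝ} (hy : S ≤ y) (ha : ∀ j, 0 ≤ a j) :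
    Integrable (fun ω => projectedPosition μ X S k (max (y - X ω + a 0) S)
      (fun j => a (j + 1))) μ := by
  refine Integrable.of_mem_Icc S (y + a 0 + ∑ j ∈ Finset.range k, a (j + 1))
    (measurable_projectedPosition_step hX k y a).aemeasurable (Eventually.of_forall fun ω => ?_)
  obtain ⟨h1, h2⟩ := projectedPosition_mem_Icc (μ := μ) hX hX0 k
    (le_max_right (y - X ω + a 0) S) fun j => ha (j + 1)
  exact ⟨h1, by linarith [max_sub_add_le hy (hX0 ω) (ha 0)]⟩

theorem projectedPosition_mono (hX : Measurable X) (hX0 : ∀ ω, 0 ≤ X ω) (k : ℕ) {y y' : ℝ}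
    {a : ℕ → ℝ} (hy : S ≤ y) (hyy : y ≤ y') (ha : ∀ j, 0 ≤ a j) :
    projectedPosition μ X S k y a ≤ projectedPosition μ X S k y' a := by
  induction k generalizing y y' a with
  | zero => exact hyy
  | succ k ih =>
    refine integral_mono (integrable_projectedPosition_step hX hX0 k hy ha)
      (integrable_projectedPosition_step hX hX0 k (hy.trans hyy) ha) fun ω => ?_
    exact ih (le_max_right _ _) (max_le_max (by linarith) le_rfl) fun j => ha (j + 1)

/-- Receiving every regular order one period earlier, and one more order at the end, raises the
projection by at most that last order: orders that arrive earlier can only replace expedited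
orders. -/
theorem projectedPosition_shift_le (hX : Measurable X) (hX0 : ∀ ω, 0 ≤ X ω) (k : ℕ) {y : ℝ}
    {a : ℕ → ℝ} (hy : S ≤ y) (ha : ∀ j, 0 ≤ a j) :
    projectedPosition μ X S k (y + a 0) (fun j => a (j + 1))
      ≤ projectedPosition μ X S k y a + a k := by
  induction k generalizing y a with
  | zero => exact le_rfl
  | succ k ih =>
    have h1 := integrable_projectedPosition_step (μ := μ) hX hX0 k hy ha
    have h2 := integrable_projectedPosition_step (μ := μ) hX hX0 k
      (hy.trans (le_add_of_nonneg_right (ha 0))) fun j => ha (j + 1)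
    have e : projectedPosition μ X S (k + 1) y a + a (k + 1)
        = ∫ ω, (projectedPosition μ X S k (max (y - X ω + a 0) S) (fun j => a (j + 1))
          + a (k + 1)) ∂μ := by
      rw [integral_add h1 (integrable_const _)]
      simp [projectedPosition]
    rw [e]
    refine integral_mono h2 (h1.add (integrable_const _)) fun ω => ?_
    refine le_trans (projectedPosition_mono hX hX0 k (le_max_right _ _) ?_
      fun j => ha (j + 1 + 1)) (ih (le_max_right (y - X ω + a 0) S) fun j => ha (j + 1))
    refine max_le ?_ ?_
    · linarith [le_max_left (y - X ω + a 0) S]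
    · linarith [le_max_right (y - X ω + a 0) S, ha 1]

end ProjectedPosition

section Construction

variable {Ω : Type*} [MeasurableSpace Ω]

/-- State of a PEIP policy: the expedited inventory position before ordering, and the regular
orders in the pipeline by the number of periods until they enter that position: entry `j` enters
it `j + 1` periods from now. -/
abbrev PEIPState : Type := ℝ × (ℕ → ℝ)

/-- The regular order that projects the expedited inventory position `k + 1` periods ahead onto
the level `U`. -/
def regularOrder (μ : Measure Ω) (X : Ω → ℝ) (S U : ℝ) (k : ℕ) (z : PEIPState) : ℝ :=
  U + ∫ ω, X ω ∂μ - projectedPosition μ X S k (max z.1 S) z.2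

/-- The pipeline of regular orders after the regular order of the current period is placed. -/
def pipelineAfter (μ : Measure Ω) (X : Ω → ℝ) (S U : ℝ) (k : ℕ) (z : PEIPState) : ℕ → ℝ :=
  Function.update z.2 k (regularOrder μ X S U k z)

/-- The state after a period with demand `d`. -/
def nextState (μ : Measure Ω) (X : Ω → ℝ) (S U : ℝ) (k : ℕ) (d : ℝ) (z : PEIPState) : PEIPState :=
  (max z.1 S - d + pipelineAfter μ X S U k z 0, fun j => pipelineAfter μ X S U k z (j + 1))

/-- The state in period `t`, starting from an empty system. -/
def peipState (μ : Measure Ω) (D : ℕ → Ω → ℝ) (S U : ℝ) (k : ℕ) : ℕ → Ω → PEIPState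
  | 0, _ => (0, 0)
  | t + 1, ω => nextState μ (D 0) S U k (D t ω) (peipState μ D S U k t ω)

/-- A state is feasible if its pipeline is non-negative and the projection level `U` is reached
without a negative regular order. -/
structure Feasible (μ : Measure Ω) (X : Ω → ℝ) (S U : ℝ) (k : ℕ) (z : PEIPState) : Prop where
  pipeline_nonneg : ∀ j, 0 ≤ z.2 j
  regularOrder_nonneg : 0 ≤ regularOrder μ X S U k z

variable {μ : Measure Ω} {X : Ω → ℝ} {S U : ℝ} {k : ℕ}

theorem Feasible.pipelineAfter_nonneg {z : PEIPState} (hz : Feasible μ X S U k z) (j : ℕ) :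
    0 ≤ pipelineAfter μ X S U k z j := by
  by_cases h : j = k
  · subst h; simpa [pipelineAfter] using hz.regularOrder_nonneg
  · simpa [pipelineAfter, h] using hz.pipeline_nonneg j

theorem projectedPosition_pipelineAfter (z : PEIPState) (y : ℝ) :
    projectedPosition μ X S k y (pipelineAfter μ X S U k z) = projectedPosition μ X S k y z.2 :=
  projectedPosition_congr fun j hj => by simp [pipelineAfter, hj.ne]

/-- Feasibility is preserved. In the worst case the demand is `0`, and then the projection rises
by at most the regular order just placed, which brought it to the target. -/
theorem Feasible.nextState [IsProbabilityMeasure μ] (hX : Measurable X) (hX0 : ∀ ω, 0 ≤ X ω)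
    {z : PEIPState} (hz : Feasible μ X S U k z) {d : ℝ} (hd : 0 ≤ d) :
    Feasible μ X S U k (nextState μ X S U k d z) := by
  refine ⟨fun j => hz.pipelineAfter_nonneg (j + 1), ?_⟩
  have hb := hz.pipelineAfter_nonneg
  have hy : S ≤ max z.1 S := le_max_right _ _
  have h1 := projectedPosition_mono (μ := μ) (S := S) hX hX0 k (le_max_right _ _)
    (max_sub_add_le hy hd (hb 0)) fun j => hb (j + 1)
  have h2 := projectedPosition_shift_le (μ := μ) hX hX0 k hy hb
  have h3 : pipelineAfter μ X S U k z k = regularOrder μ X S U k z := by simp [pipelineAfter]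
  rw [projectedPosition_pipelineAfter, h3] at h2
  have h4 : regularOrder μ X S U k z
      = U + ∫ ω, X ω ∂μ - projectedPosition μ X S k (max z.1 S) z.2 := rfl
  change 0 ≤ U + ∫ ω, X ω ∂μ - projectedPosition μ X S k
    (max (max z.1 S - d + pipelineAfter μ X S U k z 0) S)
    (fun j => pipelineAfter μ X S U k z (j + 1))
  linarith

theorem feasible_zero [IsProbabilityMeasure μ] (hX : Measurable X) (hX0 : ∀ ω, 0 ≤ X ω)
    (hS : S ≤ 0) (hU : 0 ≤ U) : Feasible μ X S U k (0, 0) := by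
  refine ⟨fun j => le_rfl, ?_⟩
  have h1 := (projectedPosition_mem_Icc (μ := μ) hX hX0 k (a := 0) (le_max_right (0 : ℝ) S)
    fun j => le_rfl).2
  rw [max_eq_left hS] at h1
  have h2 : 0 ≤ ∫ ω, X ω ∂μ := integral_nonneg hX0
  simp only [Pi.zero_apply, Finset.sum_const_zero, add_zero] at h1
  simp only [regularOrder, max_eq_left hS]
  linarith

theorem regularOrder_le [IsProbabilityMeasure μ] (hX : Measurable X) (hX0 : ∀ ω, 0 ≤ X ω)
    {z : PEIPState} (hz : Feasible μ X S U k z) :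
    regularOrder μ X S U k z ≤ U + ∫ ω, X ω ∂μ - S := by
  have := (projectedPosition_mem_Icc (μ := μ) hX hX0 k (le_max_right z.1 S)
    hz.pipeline_nonneg).1
  unfold regularOrder
  linarith

theorem measurable_regularOrder [IsProbabilityMeasure μ] (hX : Measurable X) :
    Measurable (regularOrder μ X S U k) :=
  measurable_const.sub ((measurable_projectedPosition hX k).comp
    ((measurable_fst.max measurable_const).prodMk measurable_snd))

theorem measurable_nextState [IsProbabilityMeasure μ] (hX : Measurable X) :
    Measurable fun q : ℝ × PEIPState => nextState μ X S U k q.1 q.2 := by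
  have hb : ∀ j, Measurable fun q : ℝ × PEIPState => pipelineAfter μ X S U k q.2 j := fun j => by
    by_cases h : j = k
    · subst h
      simp only [pipelineAfter, Function.update_self]
      exact (measurable_regularOrder hX).comp measurable_snd
    · simp only [pipelineAfter, Function.update_of_ne h]
      exact (measurable_pi_apply j).comp (measurable_snd.comp measurable_snd)
  exact ((((measurable_fst.comp measurable_snd).max measurable_const).sub measurable_fst).add
    (hb 0)).prodMk (measurable_pi_lambda _ fun j => hb (j + 1))

variable {D : ℕ → Ω → ℝ}

theorem measurable_peipState [IsProbabilityMeasure μ] (hD : ∀ t, Measurable (D t)) (t : ℕ) :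
    Measurable[history D t] (peipState μ D S U k t) := by
  induction t with
  | zero => exact measurable_const
  | succ t ih =>
    exact (measurable_nextState (hD 0)).comp
      ((measurable_demand_history (Nat.lt_succ_self t)).prodMk
        (ih.mono (history_mono D (Nat.le_succ t)) le_rfl))

theorem feasible_peipState [IsProbabilityMeasure μ] (hD : ∀ t, Measurable (D t))
    (hD0 : ∀ t ω, 0 ≤ D t ω) (hS : S ≤ 0) (hU : 0 ≤ U) (t : ℕ) (ω : Ω) :
    Feasible μ (D 0) S U k (peipState μ D S U k t ω) := by
  induction t with
  | zero => exact feasible_zero (hD 0) (hD0 0) hS hU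
  | succ t ih => exact ih.nextState (hD 0) (hD0 0) (hD0 t ω)

/-- The PEIP policy with order-up-to level `S ≤ 0` and projection level `U ≥ 0`, for a difference
of `k + 1` periods between the lead times. -/
def peipPolicy (μ : Measure Ω) [IsProbabilityMeasure μ] (hD : ∀ t, Measurable (D t))
    (hD0 : ∀ t ω, 0 ≤ D t ω) (hS : S ≤ 0) (hU : 0 ≤ U) (k : ℕ) : Policy D where
  expedited t ω := max (S - (peipState μ D S U k t ω).1) 0
  regular t ω := regularOrder μ (D 0) S U k (peipState μ D S U k t ω)
  expedited_nonneg _ _ := le_max_right _ _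
  regular_nonneg t ω := (feasible_peipState hD hD0 hS hU t ω).regularOrder_nonneg
  expedited_adapted t :=
    (measurable_const.sub (measurable_fst.comp (measurable_peipState hD t))).max measurable_const
  regular_adapted t := (measurable_regularOrder (hD 0)).comp (measurable_peipState hD t)

theorem max_peipState_eq (μ : Measure Ω) (D : ℕ → Ω → ℝ) (S U : ℝ) (k t : ℕ) (ω : Ω) :
    max (peipState μ D S U k t ω).1 S
      = (peipState μ D S U k t ω).1 + max (S - (peipState μ D S U k t ω).1) 0 := by
  rw [← max_add_add_left, add_sub_cancel, add_zero, max_comm]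

/-- The entries of the pipeline are the regular orders of the last `k + 1` periods. -/
theorem pipelineAfter_peipState (μ : Measure Ω) (D : ℕ → Ω → ℝ) (S U : ℝ) (k t : ℕ) (ω : Ω)
    {j : ℕ} (hj : j ≤ k) :
    pipelineAfter μ (D 0) S U k (peipState μ D S U k t ω) j
      = if k ≤ t + j then regularOrder μ (D 0) S U k (peipState μ D S U k (t + j - k) ω) else 0 := by
  induction t generalizing j with
  | zero =>
    rcases hj.eq_or_lt with rfl | hj
    · simp [pipelineAfter]
    · rw [if_neg (by omega)]
      simp [pipelineAfter, hj.ne, peipState]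
  | succ t ih =>
    rcases hj.eq_or_lt with rfl | hj
    · simp [pipelineAfter]
    · have h1 : pipelineAfter μ (D 0) S U k (peipState μ D S U k (t + 1) ω) j
          = pipelineAfter μ (D 0) S U k (peipState μ D S U k t ω) (j + 1) := by
        conv_lhs => rw [pipelineAfter, Function.update_of_ne hj.ne]
        rfl
      rw [h1, ih hj]
      have h2 : t + (j + 1) = t + 1 + j := by omega
      rw [h2]

section Policy

variable [IsProbabilityMeasure μ]

theorem peipPolicy_expeditedPosition (hD : ∀ t, Measurable (D t)) (hD0 : ∀ t ω, 0 ≤ D t ω)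
    (hS : S ≤ 0) (hU : 0 ≤ U) {le lr : ℕ} (hk : lr - le = k + 1) (t : ℕ) (ω : Ω) :
    (peipPolicy μ hD hD0 hS hU k).expeditedPosition le lr t ω = (peipState μ D S U k t ω).1 := by
  set π := peipPolicy μ hD hD0 hS hU k with hπ
  induction t with
  | zero => simp [Policy.expeditedPosition, hk, peipState]
  | succ t ih =>
    have h1 : (peipState μ D S U k (t + 1) ω).1
        = max (peipState μ D S U k t ω).1 S - D t ω
          + pipelineAfter μ (D 0) S U k (peipState μ D S U k t ω) 0 := rfl
    have h2 : π.expedited t ω = max (S - (peipState μ D S U k t ω).1) 0 := rfl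
    rw [h1, max_peipState_eq, ← h2, ← ih, pipelineAfter_peipState μ D S U k t ω (Nat.zero_le k)]
    simp only [Policy.expeditedPosition, hk, Nat.add_zero]
    split_ifs with h
    · have h3 : t + 1 + 1 - (k + 1) = t + 1 - (k + 1) + 1 := by omega
      have h4 : t + 1 - (k + 1) = t - k := by omega
      have h5 : π.regular (t - k) ω
        = regularOrder μ (D 0) S U k (peipState μ D S U k (t - k) ω) := rfl
      rw [h3, h4, Finset.sum_range_succ, Finset.sum_range_succ _ (t - k),
        Finset.sum_range_succ _ t, h5]
      ring
    · have h3 : t + 1 + 1 - (k + 1) = 0 := by omega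
      have h4 : t + 1 - (k + 1) = 0 := by omega
      rw [h3, h4, Finset.sum_range_succ, Finset.sum_range_succ _ t]
      ring

theorem peipPolicy_orderPosition (hD : ∀ t, Measurable (D t)) (hD0 : ∀ t ω, 0 ≤ D t ω)
    (hS : S ≤ 0) (hU : 0 ≤ U) (t : ℕ) (ω : Ω) :
    (peipPolicy μ hD hD0 hS hU k).orderPosition t ω
      = max (peipState μ D S U k t ω).1 S
        + ∑ j ∈ Finset.range (k + 1), pipelineAfter μ (D 0) S U k (peipState μ D S U k t ω) j := by
  set π := peipPolicy μ hD hD0 hS hU k with hπ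
  have hlast : ∀ t, ∑ j ∈ Finset.range (k + 1),
      pipelineAfter μ (D 0) S U k (peipState μ D S U k t ω) j
      = ∑ j ∈ Finset.range k, (peipState μ D S U k t ω).2 j + π.regular t ω := fun t => by
    rw [Finset.sum_range_succ]
    congr 1
    · exact Finset.sum_congr rfl fun j hj => by
        simp [pipelineAfter, (Finset.mem_range.1 hj).ne]
    · simp [pipelineAfter, hπ, peipPolicy]
  induction t with
  | zero =>
    have h2 : π.expedited 0 ω = max (S - (peipState μ D S U k 0 ω).1) 0 := rfl
    rw [hlast, max_peipState_eq, ← h2]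
    simp [Policy.orderPosition, peipState]
  | succ t ih =>
    have h2 : π.expedited (t + 1) ω = max (S - (peipState μ D S U k (t + 1) ω).1) 0 := rfl
    have h3 : (peipState μ D S U k (t + 1) ω).1
        = max (peipState μ D S U k t ω).1 S - D t ω
          + pipelineAfter μ (D 0) S U k (peipState μ D S U k t ω) 0 := rfl
    have h4 : ∑ j ∈ Finset.range k, (peipState μ D S U k (t + 1) ω).2 j
        = ∑ j ∈ Finset.range k,
          pipelineAfter μ (D 0) S U k (peipState μ D S U k t ω) (j + 1) := rfl
    have h5 : π.orderPosition (t + 1) ω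
        = π.orderPosition t ω - D t ω + π.expedited (t + 1) ω + π.regular (t + 1) ω := by
      simp only [Policy.orderPosition]
      rw [Finset.sum_range_succ _ (t + 1), Finset.sum_range_succ _ (t + 1),
        Finset.sum_range_succ (fun i => D i ω) t]
      ring
    rw [hlast, max_peipState_eq, ← h2, h3, h4, h5, ih, Finset.sum_range_succ']
    ring

/-- The inventory position after ordering never falls below the projection level, because the
projection is at most the position reached without demand. -/
theorem le_peipPolicy_orderPosition (hD : ∀ t, Measurable (D t)) (hD0 : ∀ t ω, 0 ≤ D t ω)
    (hS : S ≤ 0) (hU : 0 ≤ U) (t : ℕ) (ω : Ω) :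
    U ≤ (peipPolicy μ hD hD0 hS hU k).orderPosition t ω := by
  have hf := feasible_peipState (k := k) (μ := μ) hD hD0 hS hU t ω
  set z := peipState μ D S U k t ω with hz
  have h1 := (projectedPosition_mem_Icc (μ := μ) (hD 0) (hD0 0) k (le_max_right z.1 S)
    hf.pipelineAfter_nonneg).2
  rw [projectedPosition_pipelineAfter] at h1
  have h2 : pipelineAfter μ (D 0) S U k z k
      = U + ∫ ω, D 0 ω ∂μ - projectedPosition μ (D 0) S k (max z.1 S) z.2 := by
    simp [pipelineAfter, regularOrder]
  have h3 : 0 ≤ ∫ ω, D 0 ω ∂μ := integral_nonneg (hD0 0)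
  rw [peipPolicy_orderPosition, ← hz, Finset.sum_range_succ, h2]
  linarith

theorem integrable_regular (hD : ∀ t, Measurable (D t)) (hD0 : ∀ t ω, 0 ≤ D t ω)
    (hS : S ≤ 0) (hU : 0 ≤ U) (t : ℕ) : Integrable ((peipPolicy μ hD hD0 hS hU k).regular t) μ := by
  set π := peipPolicy μ hD hD0 hS hU k with hπ
  exact Integrable.of_mem_Icc 0 (U + ∫ ω, D 0 ω ∂μ - S)
    ((π.regular_adapted t).mono (history_le hD t) le_rfl).aemeasurable
    (Eventually.of_forall fun ω => ⟨π.regular_nonneg t ω,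
      regularOrder_le (hD 0) (hD0 0) (feasible_peipState hD hD0 hS hU t ω)⟩)

theorem peipState_succ_fst (hD : ∀ t, Measurable (D t)) (hD0 : ∀ t ω, 0 ≤ D t ω)
    (hS : S ≤ 0) (hU : 0 ≤ U) (t : ℕ) (ω : Ω) :
    (peipState μ D S U k (t + 1) ω).1 = max (peipState μ D S U k t ω).1 S - D t ω
      + if k ≤ t then (peipPolicy μ hD hD0 hS hU k).regular (t - k) ω else 0 := by
  have h := pipelineAfter_peipState μ D S U k t ω (Nat.zero_le k)
  rw [Nat.add_zero] at h
  exact congrArg (max (peipState μ D S U k t ω).1 S - D t ω + ·) h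

theorem integrable_peipState_fst (hD : ∀ t, Measurable (D t)) (hD0 : ∀ t ω, 0 ≤ D t ω)
    (hS : S ≤ 0) (hU : 0 ≤ U) (hint : ∀ t, Integrable (D t) μ) (t : ℕ) :
    Integrable (fun ω => (peipState μ D S U k t ω).1) μ := by
  induction t with
  | zero => simp [peipState]
  | succ t ih =>
    simp only [peipState_succ_fst hD hD0 hS hU]
    refine ((ih.sup (integrable_const S)).sub (hint t)).add ?_
    split_ifs
    · exact integrable_regular hD hD0 hS hU (t - k)
    · exact integrable_const 0

/-- The projection is the conditional expectation of the position after ordering. -/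
theorem condExp_max_peipState (hD : ∀ t, Measurable (D t)) (hD0 : ∀ t ω, 0 ≤ D t ω)
    (hS : S ≤ 0) (hU : 0 ≤ U) (hindep : iIndepFun D μ)
    (hident : ∀ t, IdentDistrib (D t) (D 0) μ μ) (hint : ∀ t, Integrable (D t) μ)
    {j : ℕ} (hj : j ≤ k) (t : ℕ) :
    μ[fun ω => max (peipState μ D S U k (t + j) ω).1 S | history D t]
      =ᵐ[μ] fun ω => projectedPosition μ (D 0) S j (max (peipState μ D S U k t ω).1 S)
        (peipState μ D S U k t ω).2 := by
  have hmax : ∀ t, Integrable (fun ω => max (peipState μ D S U k t ω).1 S) μ := fun t =>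
    (integrable_peipState_fst hD hD0 hS hU hint t).sup (integrable_const S)
  induction j generalizing t with
  | zero =>
    have hm : Measurable[history D t] fun ω => max (peipState μ D S U k t ω).1 S :=
      (measurable_fst.comp (measurable_peipState hD t)).max measurable_const
    rw [Nat.add_zero, condExp_of_stronglyMeasurable (history_le hD t) hm.stronglyMeasurable
      (hmax t)]
    rfl
  | succ j ih =>
    have hle := history_mono D (Nat.le_succ t)
    have h1 := (condExp_condExp_of_le (μ := μ)
      (f := fun ω => max (peipState μ D S U k (t + (j + 1)) ω).1 S) hle
      (history_le hD (t + 1))).symm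
    let f : PEIPState → ℝ → ℝ := fun z d =>
      projectedPosition μ (D 0) S j (max (max z.1 S - d + z.2 0) S) (fun i => z.2 (i + 1))
    have hf : Measurable (Function.uncurry f) := by
      refine (measurable_projectedPosition (hD 0) j).comp
        (Measurable.prodMk ?_ (measurable_pi_lambda _ fun i => ?_))
      · have h0 : Measurable fun q : PEIPState × ℝ => q.1.2 0 :=
          (measurable_pi_apply 0).comp (measurable_snd.comp measurable_fst)
        have h1 : Measurable fun q : PEIPState × ℝ => max q.1.1 S :=
          (measurable_fst.comp measurable_fst).max measurable_const
        exact ((h1.sub measurable_snd).add h0).max measurable_const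
      · exact (measurable_pi_apply (i + 1)).comp (measurable_snd.comp measurable_fst)
    have h2 := ih (by omega) (t + 1)
    rw [show t + 1 + j = t + (j + 1) by omega] at h2
    -- For `j < k`, neither the next state nor its projection sees the order placed now.
    have h3 : (fun ω => projectedPosition μ (D 0) S j (max (peipState μ D S U k (t + 1) ω).1 S)
        (peipState μ D S U k (t + 1) ω).2) = fun ω => f (peipState μ D S U k t ω) (D t ω) := by
      funext ω
      have hp : ∀ i < k, pipelineAfter μ (D 0) S U k (peipState μ D S U k t ω) i
          = (peipState μ D S U k t ω).2 i := fun i hi => by simp [pipelineAfter, hi.ne]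
      have e : (peipState μ D S U k (t + 1) ω).1 = max (peipState μ D S U k t ω).1 S - D t ω
          + (peipState μ D S U k t ω).2 0 := by
        rw [← hp 0 (by omega)]; rfl
      rw [e]
      exact projectedPosition_congr fun i hi => hp (i + 1) (by omega)
    rw [h3] at h2
    have h4 : Integrable (fun ω => f (peipState μ D S U k t ω) (D t ω)) μ :=
      (integrable_condExp.congr h2)
    exact h1.trans ((condExp_congr_ae h2).trans
      (condExp_freeze hD hindep hident t (measurable_peipState hD t) hf h4))

theorem condExp_demand (hD : ∀ t, Measurable (D t)) (hindep : iIndepFun D μ)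
    (hident : ∀ t, IdentDistrib (D t) (D 0) μ μ) {s t : ℕ} (hst : s ≤ t) :
    μ[D t | history D s] =ᵐ[μ] fun _ => ∫ ω, D 0 ω ∂μ := by
  have hi := indep_of_indep_of_le_right (indep_history_future hD hindep s)
    (le_iSup₂_of_le (f := fun i (_ : i ∈ Set.Ici s) =>
      MeasurableSpace.comap (D i) inferInstance) t hst le_rfl)
  rw [← (hident t).integral_eq]
  exact condExp_indep_eq (hD t).comap_le (history_le hD s)
    (comap_measurable (D t)).stronglyMeasurable hi.symm

theorem isPEIP_peipPolicy (hD : ∀ t, Measurable (D t)) (hD0 : ∀ t ω, 0 ≤ D t ω)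
    (hS : S ≤ 0) (hU : 0 ≤ U) (hindep : iIndepFun D μ)
    (hident : ∀ t, IdentDistrib (D t) (D 0) μ μ) (hint : ∀ t, Integrable (D t) μ)
    {le lr : ℕ} (hk : lr - le = k + 1) :
    (peipPolicy μ hD hD0 hS hU k).IsPEIP μ le lr S U := by
  set π := peipPolicy μ hD hD0 hS hU k with hπ
  have hpos : ∀ t, π.expeditedPosition le lr t = fun ω => (peipState μ D S U k t ω).1 :=
    fun t => funext fun ω => peipPolicy_expeditedPosition hD hD0 hS hU hk t ω
  refine ⟨fun t ω => ?_, fun t => ?_, fun t => ?_⟩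
  · rw [hpos]; rfl
  · rw [hpos]; exact integrable_peipState_fst hD hD0 hS hU hint _
  · have hreg : Integrable (π.regular t) μ := integrable_regular hD hD0 hS hU t
    have hmax : Integrable (fun ω => max (peipState μ D S U k (t + k) ω).1 S) μ :=
      (integrable_peipState_fst hD hD0 hS hU hint (t + k)).sup (integrable_const S)
    have e : π.expeditedPosition le lr (t + (lr - le))
        = (fun ω => max (peipState μ D S U k (t + k) ω).1 S) - D (t + k) + π.regular t := by
      rw [hpos, hk, ← Nat.add_assoc]
      funext ω
      rw [peipState_succ_fst hD hD0 hS hU, if_pos (Nat.le_add_left k t), Nat.add_sub_cancel]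
      rfl
    rw [e]
    have h1 := condExp_add (hmax.sub (hint (t + k))) hreg (history D t)
    have h2 := condExp_sub hmax (hint (t + k)) (history D t)
    have h3 := condExp_max_peipState hD hD0 hS hU hindep hident hint (le_refl k) t
    have h4 := condExp_demand hD hindep hident (Nat.le_add_right t k)
    have h5 : μ[π.regular t | history D t] = π.regular t :=
      condExp_of_stronglyMeasurable (history_le hD t) (π.regular_adapted t).stronglyMeasurable hreg
    filter_upwards [h1, h2, h3, h4] with ω h1 h2 h3 h4
    have h6 : π.regular t ω = U + ∫ ω, D 0 ω ∂μ - projectedPosition μ (D 0) S k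
      (max (peipState μ D S U k t ω).1 S) (peipState μ D S U k t ω).2 := rfl
    rw [h1, Pi.add_apply, h2, Pi.sub_apply, h3, h4, h5, h6]
    ring

end Policy

end Construction

end

end DualSourcing

/-! ### Upper bound for PEIP policies -/

namespace DualSourcing

/-- An eventual upper bound on finite costs per period bounds the long-run average. -/
theorem limsup_average_le {a : ℕ → ℝ≥0∞} {c : ℝ≥0∞} {N : ℕ} (ha : ∀ t, a t ≠ ∞)
    (hN : ∀ t, N ≤ t → a t ≤ c) :
    limsup (fun T : ℕ => (∑ t ∈ Finset.Icc 1 T, a t) / (T : ℝ≥0∞)) atTop ≤ c := by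
  set K := ∑ t ∈ Finset.range N, a t with hK
  have hKtop : K ≠ ∞ := ENNReal.sum_ne_top.2 fun t _ => ha t
  have hsum : ∀ T : ℕ, ∑ t ∈ Finset.Icc 1 T, a t ≤ K + T * c := fun T => by
    have h1 : ∀ t ∈ Finset.Icc 1 T, a t ≤ (if t ∈ Finset.range N then a t else 0) + c :=
      fun t _ => by
        split_ifs with h
        · exact le_self_add
        · rw [zero_add]
          exact hN t (not_lt.1 fun h' => h (Finset.mem_range.2 h'))
    refine (Finset.sum_le_sum h1).trans ?_
    rw [Finset.sum_add_distrib, Finset.sum_ite_mem]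
    refine add_le_add (Finset.sum_le_sum_of_subset Finset.inter_subset_right) ?_
    simp
  have hlim : Tendsto (fun T : ℕ => K / (T : ℝ≥0∞) + c) atTop (𝓝 c) := by
    have := (ENNReal.Tendsto.const_div ENNReal.tendsto_nat_nhds_top (Or.inr hKtop)).add_const c
    simpa using this
  rw [← hlim.limsup_eq]
  refine limsup_le_limsup ?_
  filter_upwards [eventually_ge_atTop 1] with T hT
  have hT0 : (T : ℝ≥0∞) ≠ 0 := by exact_mod_cast (by omega : T ≠ 0)
  calc (∑ t ∈ Finset.Icc 1 T, a t) / (T : ℝ≥0∞) ≤ (K + T * c) / T :=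
        ENNReal.div_le_div_right (hsum T) _
    _ = K / T + c := by
        rw [ENNReal.add_div, mul_comm, ENNReal.mul_div_cancel_right hT0 (ENNReal.natCast_ne_top T)]

noncomputable section

variable {Ω : Type*} {D : ℕ → Ω → ℝ}

namespace Policy

theorem expeditedPosition_add (π : Policy D) (le lr t : ℕ) (ω : Ω) :
    π.expeditedPosition le lr (t + (lr - le)) ω
      = (π.orderPosition t ω - π.expedited t ω)
        + ∑ i ∈ Finset.range (lr - le), π.expedited (t + i) ω
        - blockDemand D (lr - le) t ω := by
  have h : t + (lr - le) + 1 - (lr - le) = t + 1 := by omega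
  rw [expeditedPosition, h, Finset.sum_range_add (fun i => π.expedited i ω),
    sum_range_add_eq D, orderPosition, Finset.sum_range_succ (fun i => π.expedited i ω) t]
  ring

variable [MeasurableSpace Ω] {μ : Measure Ω}

/-- Under a PEIP policy whose inventory position stays above `U`, an expedited order requires
that the demand of a few periods exceeds `U - S`. -/
theorem IsPEIP.expedited_le {π : Policy D} {le lr : ℕ} {S U : ℝ} (hπ : π.IsPEIP μ le lr S U)
    (hl : le < lr) (hD0 : ∀ t ω, 0 ≤ D t ω) (hU : ∀ t ω, U ≤ π.orderPosition t ω)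
    (t : ℕ) (ω : Ω) :
    π.expedited (t + (lr - le)) ω ≤ max (blockDemand D (lr + 1) t ω - (U - S)) 0 := by
  rw [hπ.expedited_eq]
  refine max_le_max ?_ le_rfl
  obtain ⟨k, hk⟩ : ∃ k, lr - le = k + 1 := ⟨lr - le - 1, by omega⟩
  have h1 := π.expeditedPosition_add le lr t ω
  have h2 : π.expedited t ω ≤ ∑ i ∈ Finset.range (lr - le), π.expedited (t + i) ω := by
    have := Finset.single_le_sum (f := fun i => π.expedited (t + i) ω)
      (fun i _ => π.expedited_nonneg (t + i) ω) (Finset.mem_range.2 (by omega : 0 < lr - le))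
    simpa using this
  have h3 := blockDemand_mono hD0 (by omega : lr - le ≤ lr + 1) t ω
  linarith [hU t ω]

/-- If the mean expedited orders are at most `δ`, the expected cost of a period under a PEIP policy
exceeds the newsvendor cost by at most a multiple of `δ`. -/
theorem IsPEIP.integral_cost_le [IsProbabilityMeasure μ] {π : Policy D} {le lr : ℕ} {S U : ℝ}
    (hπ : π.IsPEIP μ le lr S U) (hl : le < lr) (hD : ∀ t, Measurable (D t))
    (hindep : iIndepFun D μ)
    (hident : ∀ t, IdentDistrib (D t) (D 0) μ μ) (hint : ∀ t, Integrable (D t) μ)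
    (he : ∀ t, Integrable (π.expedited t) μ) (hr : ∀ t, Integrable (π.regular t) μ)
    {p h ce δ : ℝ} (hp : 0 ≤ p) (hh : 0 ≤ h) (hce : 0 ≤ ce) (t : ℕ)
    (hδ : ∀ i, t ≤ i → ∫ ω, π.expedited i ω ∂μ ≤ δ) :
    ∫ ω, π.cost p h ce le lr (t + lr) ω ∂μ
      ≤ newsvendorCost μ (blockDemand D (lr + 1) 0) h p (U + (lr - le : ℕ) * ∫ ω, D 0 ω ∂μ)
        + (ce + (h + p) * (2 * (lr - le : ℕ) + 1)) * δ := by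
  set l := lr - le with hldef
  set m := ∫ ω, D 0 ω ∂μ with hm
  set A : Ω → ℝ := fun ω => π.orderPosition t ω - π.expedited t ω with hA
  set V : Ω → ℝ := fun ω => ∑ i ∈ Finset.range l, π.expedited (t + i) ω with hV
  set V' : Ω → ℝ := fun ω => ∑ i ∈ Finset.range (l + 1), π.expedited (t + i) ω with hV'
  have hVint : Integrable V μ := integrable_finsetSum _ fun i _ => he (t + i)
  have hV'int : Integrable V' μ := integrable_finsetSum _ fun i _ => he (t + i)
  have hblock : ∀ n s, Integrable (blockDemand D n s) μ := fun n s =>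
    integrable_finsetSum _ fun i _ => hint (s + i)
  have hAint : Integrable A μ := by
    refine Integrable.sub (Integrable.sub (Integrable.add ?_ ?_) ?_) (he t)
    · exact integrable_finsetSum _ fun i _ => he i
    · exact integrable_finsetSum _ fun i _ => hr i
    · exact integrable_finsetSum _ fun i _ => hint i
  have hAmeas : Measurable[history D t] A :=
    (π.measurable_orderPosition t).sub (π.expedited_adapted t)
  set W : Ω → ℝ := μ[V | history D t] with hW
  -- The projection property expresses the known part of the inventory position through `W`.
  have hAW : A =ᵐ[μ] fun ω => U + l * m - W ω := by
    have e : π.expeditedPosition le lr (t + l) = A + V - blockDemand D l t :=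
      funext fun ω => π.expeditedPosition_add le lr t ω
    have h0 := hπ.projected t
    rw [← hldef, e] at h0
    have h1 := condExp_sub (hAint.add hVint) (hblock l t) (history D t)
    have h2 := condExp_add hAint hVint (history D t)
    have h3 : μ[A | history D t] = A :=
      condExp_of_stronglyMeasurable (history_le hD t) hAmeas.stronglyMeasurable hAint
    have h4 : μ[blockDemand D l t | history D t] =ᵐ[μ] fun _ => l * m := by
      have h5 := condExp_finsetSum (s := Finset.range l) (μ := μ) (f := fun i => D (t + i))
        (fun i _ => hint (t + i)) (history D t)
      have h6 : ∀ᵐ ω ∂μ, ∀ i, (μ[D (t + i) | history D t]) ω = m := ae_all_iff.2 fun i =>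
        condExp_demand hD hindep hident (Nat.le_add_right t i)
      have h7 : (∑ i ∈ Finset.range l, D (t + i)) = blockDemand D l t := by
        funext ω; simp [blockDemand]
      rw [h7] at h5
      filter_upwards [h5, h6] with ω h5 h6
      rw [h5, Finset.sum_apply, Finset.sum_congr rfl fun i _ => h6 i]
      simp
    filter_upwards [h0, h1, h2, h4] with ω h0 h1 h2 h4
    rw [h1, Pi.sub_apply, h2, Pi.add_apply, h3, h4] at h0
    linarith
  set s := U + l * m with hs
  have hbound : ∀ᵐ ω ∂μ, π.cost p h ce le lr (t + lr) ω
      ≤ ce * π.expedited (t + lr) ω + periodCost h p (s - blockDemand D (lr + 1) t ω)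
        + (h + p) * (V' ω + |W ω|) := by
    filter_upwards [hAW] with ω hω
    have h1 := π.netInventory_sub_demand hl t ω
    have h2 : V' ω = ∑ i ∈ Finset.range l, π.expedited (t + 1 + i) ω + π.expedited t ω := by
      simp only [hV']
      rw [Finset.sum_range_succ']
      simp [Nat.add_assoc, Nat.add_comm 1]
    have h3 : π.netInventory le lr (t + lr) ω - D (t + lr) ω
        = (s - blockDemand D (lr + 1) t ω) + (V' ω - W ω) := by
      rw [h1, h2]
      have : π.orderPosition t ω - π.expedited t ω = s - W ω := hω
      linarith
    have h4 := periodCost_add_le hh hp (s - blockDemand D (lr + 1) t ω) (V' ω - W ω)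
    have h5 : |V' ω - W ω| ≤ V' ω + |W ω| := by
      have : |V' ω| = V' ω := abs_of_nonneg (Finset.sum_nonneg fun i _ => π.expedited_nonneg _ ω)
      rw [← this]
      exact (abs_sub _ _).trans (by simp)
    have h6 := mul_le_mul_of_nonneg_left h5 (add_nonneg hh hp)
    rw [π.cost_eq, h3]
    linarith
  have hcost0 : ∀ ω, 0 ≤ π.cost p h ce le lr (t + lr) ω := fun ω => by
    rw [π.cost_eq]
    exact add_nonneg (mul_nonneg hce (π.expedited_nonneg _ ω)) (periodCost_nonneg hh hp _)
  have hi1 := (he (t + lr)).const_mul ce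
  have hi2 := integrable_periodCost (hblock (lr + 1) t) h p s
  have hi3 : Integrable (fun ω => V' ω + |W ω|) μ := hV'int.add integrable_condExp.abs
  have hi4 : Integrable (fun ω => ce * π.expedited (t + lr) ω
      + periodCost h p (s - blockDemand D (lr + 1) t ω)) μ := hi1.add hi2
  have hi5 : Integrable (fun ω => ce * π.expedited (t + lr) ω
      + periodCost h p (s - blockDemand D (lr + 1) t ω) + (h + p) * (V' ω + |W ω|)) μ :=
    hi4.add (hi3.const_mul (h + p))
  have hle := integral_mono_of_nonneg (Eventually.of_forall hcost0) hi5 hbound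
  have e1 : ∫ ω, (ce * π.expedited (t + lr) ω + periodCost h p (s - blockDemand D (lr + 1) t ω)
        + (h + p) * (V' ω + |W ω|)) ∂μ
      = ce * ∫ ω, π.expedited (t + lr) ω ∂μ
        + ∫ ω, periodCost h p (s - blockDemand D (lr + 1) t ω) ∂μ
        + (h + p) * (∫ ω, V' ω ∂μ + ∫ ω, |W ω| ∂μ) := by
    rw [integral_add hi4 (hi3.const_mul (h + p)), integral_add hi1 hi2,
      integral_const_mul, integral_const_mul, integral_add hV'int integrable_condExp.abs]
  have e2 : ∫ ω, periodCost h p (s - blockDemand D (lr + 1) t ω) ∂μ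
      = newsvendorCost μ (blockDemand D (lr + 1) 0) h p s :=
    ((identDistrib_blockDemand hindep hident (lr + 1) t).comp
      ((measurable_periodCost h p).comp (measurable_const.sub measurable_id))).integral_eq
  have hsumle : ∀ n : ℕ, ∫ ω, ∑ i ∈ Finset.range n, π.expedited (t + i) ω ∂μ ≤ n * δ := fun n => by
    rw [integral_finsetSum _ fun i _ => he (t + i)]
    refine (Finset.sum_le_sum fun i _ => hδ (t + i) (Nat.le_add_right t i)).trans ?_
    simp
  have h1 := hδ (t + lr) (Nat.le_add_right t lr)
  have h2 : ∫ ω, V' ω ∂μ ≤ (l + 1) * δ := by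
    have := hsumle (l + 1)
    push_cast at this
    exact this
  have h3 : ∫ ω, |W ω| ∂μ ≤ l * δ := by
    refine (integral_abs_condExp_le V).trans ?_
    refine le_trans (le_of_eq (integral_congr_ae (Eventually.of_forall fun ω => ?_))) (hsumle l)
    exact abs_of_nonneg (Finset.sum_nonneg fun i _ => π.expedited_nonneg _ ω)
  have h4 := mul_le_mul_of_nonneg_left h1 hce
  have h5 := mul_le_mul_of_nonneg_left (add_le_add h2 h3) (add_nonneg hh hp)
  refine hle.trans ?_
  rw [e1, e2]
  linarith

theorem integrable_cost [IsProbabilityMeasure μ] {π : Policy D} (hint : ∀ t, Integrable (D t) μ)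
    (he : ∀ t, Integrable (π.expedited t) μ) (hr : ∀ t, Integrable (π.regular t) μ)
    (p h ce : ℝ) (le lr t : ℕ) : Integrable (π.cost p h ce le lr t) μ := by
  have hI : Integrable (π.netInventory le lr t) μ :=
    ((integrable_finsetSum _ fun i _ => he i).add (integrable_finsetSum _ fun i _ => hr i)).sub
      (integrable_finsetSum _ fun i _ => hint i)
  exact (((he t).const_mul ce).add ((hI.sub (hint t)).pos_part.const_mul h)).add
    (((hint t).sub hI).pos_part.const_mul p)

end Policy

section UpperBound

variable [MeasurableSpace Ω] {μ : Measure Ω} [IsProbabilityMeasure μ]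

/-- With a very low order-up-to level expediting becomes negligible, and the best PEIP policy
costs at most as much as any newsvendor facing the demand of `lr + 1` periods. -/
theorem bestPEIPCost_le (hD : ∀ t, Measurable (D t)) (hD0 : ∀ t ω, 0 ≤ D t ω)
    (hindep : iIndepFun D μ) (hident : ∀ t, IdentDistrib (D t) (D 0) μ μ)
    (hint : ∀ t, Integrable (D t) μ) {le lr : ℕ} (hl : le < lr) {p h ce : ℝ} (hp : 0 ≤ p)
    (hh : 0 ≤ h) (hce : 0 ≤ ce) {s : ℝ} (hs : (lr - le : ℕ) * ∫ ω, D 0 ω ∂μ ≤ s) :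
    bestPEIPCost μ D p h ce le lr
      ≤ ENNReal.ofReal (newsvendorCost μ (blockDemand D (lr + 1) 0) h p s) := by
  obtain ⟨k, hk⟩ : ∃ k, lr - le = k + 1 := ⟨lr - le - 1, by omega⟩
  set U := s - (lr - le : ℕ) * ∫ ω, D 0 ω ∂μ with hUdef
  have hU : 0 ≤ U := sub_nonneg.2 hs
  set X := blockDemand D (lr + 1) 0 with hX
  have hXint : Integrable X μ := integrable_finsetSum _ fun i _ => hint (0 + i)
  set C := ce + (h + p) * (2 * (lr - le : ℕ) + 1) with hC
  have hcostS : ∀ S ≤ 0, bestPEIPCost μ D p h ce le lr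
      ≤ ENNReal.ofReal (newsvendorCost μ X h p s + C * meanExcess μ X (U - S)) := by
    intro S hS
    set π := peipPolicy μ hD hD0 hS hU k with hπdef
    have hπ : π.IsPEIP μ le lr S U := isPEIP_peipPolicy hD hD0 hS hU hindep hident hint hk
    have hr : ∀ t, Integrable (π.regular t) μ := integrable_regular hD hD0 hS hU
    have he : ∀ t, Integrable (π.expedited t) μ := fun t =>
      ((integrable_const S).sub (integrable_peipState_fst hD hD0 hS hU hint t)).pos_part
    refine (iInf_le_of_le S <| iInf_le_of_le U <| iInf_le_of_le π <| iInf_le_of_le hπ le_rfl).trans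
      ?_
    have hδ : ∀ i, lr - le ≤ i → ∫ ω, π.expedited i ω ∂μ ≤ meanExcess μ X (U - S) := by
      intro i hi
      obtain ⟨t, rfl⟩ := Nat.exists_eq_add_of_le' hi
      have h1 := ((identDistrib_blockDemand hindep hident (lr + 1) t).comp
        (u := fun x => max (x - (U - S)) 0) (by fun_prop)).integral_eq
      have h2 : Integrable (fun ω => max (blockDemand D (lr + 1) t ω - (U - S)) 0) μ :=
        integrable_excess (integrable_finsetSum _ fun i _ => hint (t + i)) _
      refine (integral_mono (he _) h2 fun ω => hπ.expedited_le hl hD0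
        (fun t ω => le_peipPolicy_orderPosition hD hD0 hS hU t ω) t ω).trans h1.le
    refine limsup_average_le (N := lr - le + lr) (fun t => ?_) fun t ht => ?_
    · exact (Policy.integrable_cost hint he hr p h ce le lr t).lintegral_lt_top.ne
    · obtain ⟨t, rfl⟩ := Nat.exists_eq_add_of_le' (le_trans (Nat.le_add_left lr (lr - le)) ht)
      have ht' : lr - le ≤ t := by omega
      rw [← ofReal_integral_eq_lintegral_ofReal (Policy.integrable_cost hint he hr p h ce le lr _)
        (Eventually.of_forall fun ω => by
          rw [Pi.zero_apply, π.cost_eq]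
          exact add_nonneg (mul_nonneg hce (π.expedited_nonneg _ ω)) (periodCost_nonneg hh hp _))]
      refine ENNReal.ofReal_le_ofReal ?_
      have h1 := hπ.integral_cost_le hl hD hindep hident hint he hr hp hh hce t
        fun i hi => hδ i (ht'.trans hi)
      have h2 : U + (lr - le : ℕ) * ∫ ω, D 0 ω ∂μ = s := by rw [hUdef]; ring
      rw [h2] at h1
      exact h1
  have hlim : Tendsto (fun S => ENNReal.ofReal
      (newsvendorCost μ X h p s + C * meanExcess μ X (U - S))) atBot
      (𝓝 (ENNReal.ofReal (newsvendorCost μ X h p s))) := by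
    refine ENNReal.tendsto_ofReal ?_
    have h1 : Tendsto (fun S : ℝ => U - S) atBot atTop :=
      tendsto_atTop_add_const_left _ U tendsto_neg_atBot_atTop
    simpa using (((tendsto_meanExcess hXint).comp h1).const_mul C).const_add
      (newsvendorCost μ X h p s)
  refine ge_of_tendsto hlim ?_
  filter_upwards [eventually_le_atBot 0] with S hS using hcostS S hS

end UpperBound

end

end DualSourcing

/-! ### Comparison of the bounds -/

namespace DualSourcing

section Blocks

variable {Ω : Type*} [MeasurableSpace Ω] {μ : Measure Ω} {D : ℕ → Ω → ℝ}

theorem integrable_demand_of_blockDemand (hD : ∀ t, Measurable (D t)) (hD0 : ∀ t ω, 0 ≤ D t ω)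
    (hident : ∀ t, IdentDistrib (D t) (D 0) μ μ) {n : ℕ}
    (hint : Integrable (blockDemand D (n + 1) 0) μ) (t : ℕ) : Integrable (D t) μ := by
  refine (hident t).integrable_iff.2 (hint.mono' (hD 0).aestronglyMeasurable
    (Eventually.of_forall fun ω => ?_))
  rw [Real.norm_of_nonneg (hD0 0 ω)]
  have := blockDemand_mono hD0 (Nat.succ_le_succ (Nat.zero_le n)) 0 ω
  simpa [blockDemand] using this

theorem integral_blockDemand (hident : ∀ t, IdentDistrib (D t) (D 0) μ μ)
    (hint : ∀ t, Integrable (D t) μ) (n t : ℕ) :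
    ∫ ω, blockDemand D n t ω ∂μ = n * ∫ ω, D 0 ω ∂μ := by
  simp only [blockDemand]
  rw [integral_finsetSum _ fun i _ => hint (t + i),
    Finset.sum_congr rfl fun i _ => (hident (t + i)).integral_eq]
  simp

/-- If the demand of several periods were constant, its variance, which is a multiple of the
variance of the demand of one period, would vanish. -/
theorem not_const_blockDemand [IsProbabilityMeasure μ] (hD : ∀ t, Measurable (D t)) (hD0 : ∀ t ω, 0 ≤ D t ω)
    (hindep : iIndepFun D μ) (hident : ∀ t, IdentDistrib (D t) (D 0) μ μ)
    (hrandom : ¬ ∃ c : ℝ, ∀ᵐ ω ∂μ, D 0 ω = c) (n : ℕ) :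
    ¬ ∃ c : ℝ, ∀ᵐ ω ∂μ, blockDemand D (n + 1) 0 ω = c := by
  rintro ⟨c, hc⟩
  have hL2 : ∀ t, MemLp (D t) 2 μ := fun t => by
    refine (hident t).memLp_iff.2 (MemLp.of_bound (hD 0).aestronglyMeasurable c ?_)
    filter_upwards [hc] with ω hω
    rw [Real.norm_of_nonneg (hD0 0 ω), ← hω]
    have := blockDemand_mono hD0 (Nat.succ_le_succ (Nat.zero_le n)) 0 ω
    simpa [blockDemand] using this
  have h1 : Var[∑ i ∈ Finset.range (n + 1), D i; μ] = (n + 1) * Var[D 0; μ] := by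
    rw [IndepFun.variance_sum (fun i _ => hL2 i) fun i _ j _ hij => hindep.indepFun hij,
      Finset.sum_congr rfl fun i _ => (hident i).variance_eq]
    simp
  have h2 : Var[∑ i ∈ Finset.range (n + 1), D i; μ] = 0 := by
    have : (∑ i ∈ Finset.range (n + 1), D i) =ᵐ[μ] fun _ => c := by
      filter_upwards [hc] with ω hω
      rw [← hω]
      simp [blockDemand]
    rw [variance_congr this]
    simp [variance_eq_integral aemeasurable_const]
  have h3 : Var[D 0; μ] = 0 := by
    rw [h2] at h1
    have : (0 : ℝ) < n + 1 := by positivity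
    nlinarith
  refine hrandom ⟨μ[D 0], ?_⟩
  have h4 : evariance (D 0) μ = 0 := by
    rw [← (hL2 0).ofReal_variance_eq, h3, ENNReal.ofReal_zero]
  filter_upwards [(evariance_eq_zero_iff (hD 0).aemeasurable).1 h4] with ω hω using hω

end Blocks

/-- A PEIP policy is a policy. -/
theorem optimalCost_le_bestPEIPCost {Ω : Type*} [MeasurableSpace Ω] (μ : Measure Ω)
    (D : ℕ → Ω → ℝ) (p h ce : ℝ) (le lr : ℕ) :
    optimalCost μ D p h ce le lr ≤ bestPEIPCost μ D p h ce le lr :=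
  le_iInf fun _ => le_iInf fun _ => le_iInf fun π => le_iInf fun _ => iInf_le _ π

end DualSourcing

theorem theorem1 {Ω : Type*} [MeasurableSpace Ω] (μ : Measure Ω) [IsProbabilityMeasure μ]
    (D : ℕ → Ω → ℝ) (hD_meas : ∀ t, Measurable (D t)) (hD_nonneg : ∀ t ω, 0 ≤ D t ω)
    (hD_indep : iIndepFun D μ) (hD_ident : ∀ t, IdentDistrib (D t) (D 0) μ μ)
    (hD_random : ¬ ∃ c : ℝ, ∀ᵐ ω ∂μ, D 0 ω = c)
    (le lr : ℕ) (hl : le < lr)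
    (p h ce : ℝ) (hp : 0 < p) (hh : 0 < h) (hce : 0 < ce)
    (hratio : ce / p < (lr : ℝ) - (le : ℝ))
    (hdemand : DualSourcing.DemandCondition μ
      (fun ω => ∑ i ∈ Finset.range (lr + 1), D i ω)) :
    Tendsto (fun n : ℝ =>
        DualSourcing.bestPEIPCost μ D (p * n) h (ce * n) le lr
          / DualSourcing.optimalCost μ D (p * n) h (ce * n) le lr)
      atTop (𝓝 (1 : ℝ≥0∞)) := by
  open DualSourcing in
  rw [← blockDemand_zero] at hdemand
  set X := blockDemand D (lr + 1) 0 with hX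
  have hint := integrable_demand_of_blockDemand hD_meas hD_nonneg hD_ident hdemand.integrable
  have hconst := not_const_blockDemand hD_meas hD_nonneg hD_indep hD_ident hD_random lr
  -- The backlog cost rate at which expediting a unit costs as much as the backlog it avoids.
  set l : ℝ := ((lr - le : ℕ) : ℝ) with hldef
  have hl0 : 0 < l := by rw [hldef]; exact_mod_cast Nat.sub_pos_of_lt hl
  have hl' : ce / p < l := by rwa [hldef, Nat.cast_sub hl.le]
  set c := ce / l with hcdef
  have hc : 0 < c := by positivity
  have hcp : c ≤ p := by
    rw [hcdef, div_le_iff₀ hl0, mul_comm]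
    exact ((div_lt_iff₀ hp).1 hl').le
  have hmean : (lr - le : ℕ) * ∫ ω, D 0 ω ∂μ ≤ ∫ ω, X ω ∂μ := by
    rw [hX, integral_blockDemand hD_ident hint]
    refine mul_le_mul_of_nonneg_right ?_ (integral_nonneg (hD_nonneg 0))
    exact_mod_cast (by omega : lr - le ≤ lr + 1)
  have hlower : ∀ n : ℝ, 0 ≤ n → ∀ b : ℝ, (∀ s, b ≤ newsvendorCost μ X h (c * n) s) →
      ENNReal.ofReal b ≤ optimalCost μ D (p * n) h (ce * n) le lr := fun n hn b hb => by
    refine le_optimalCost hD_meas hD_indep hD_ident hl hdemand.integrable (p' := c * n)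
      (by positivity) (mul_le_mul_of_nonneg_right hcp hn) hh.le (le_of_eq ?_) hb
    rw [← hldef, hcdef]; field_simp
  have hupper : ∀ n : ℝ, 0 ≤ n → ∀ s, ∫ ω, X ω ∂μ ≤ s →
      bestPEIPCost μ D (p * n) h (ce * n) le lr
        ≤ ENNReal.ofReal (newsvendorCost μ X h (p * n) s) := fun n hn s hs =>
    bestPEIPCost_le hD_meas hD_nonneg hD_indep hD_ident hint hl (by positivity) hh.le
      (by positivity) (hmean.trans hs)
  have hpos : ∀ n : ℝ, 0 < n → optimalCost μ D (p * n) h (ce * n) le lr ≠ 0 := fun n hn => by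
    obtain ⟨κ, hκ, hκ'⟩ := exists_pos_le_newsvendorCost hdemand.integrable hconst hh
      (mul_pos hc hn)
    exact ((ENNReal.ofReal_pos.2 hκ).trans_le (hlower n hn.le κ hκ')).ne'
  have htop : ∀ n : ℝ, 0 ≤ n → optimalCost μ D (p * n) h (ce * n) le lr ≠ ∞ := fun n hn =>
    ((optimalCost_le_bestPEIPCost μ D _ _ _ le lr).trans_lt
      ((hupper n hn _ le_rfl).trans_lt ENNReal.ofReal_lt_top)).ne
  have hratio_le : ∀ ε : ℝ, 0 < ε → ∀ᶠ n : ℝ in atTop,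
      bestPEIPCost μ D (p * n) h (ce * n) le lr / optimalCost μ D (p * n) h (ce * n) le lr
        ≤ ENNReal.ofReal (1 + ε) := fun ε hε => by
    filter_upwards [hdemand.eventually_newsvendorCost_le (measurable_blockDemand hD_meas _ 0)
      hconst hh hp hc hε, eventually_gt_atTop 0] with n hn hn0
    have hbtop : bestPEIPCost μ D (p * n) h (ce * n) le lr ≠ ∞ :=
      ((hupper n hn0.le _ le_rfl).trans_lt ENNReal.ofReal_lt_top).ne
    have hε1 : 0 < 1 + ε := by linarith
    -- The PEIP cost, divided by `1 + ε`, is below every newsvendor cost of the lower bound.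
    have h1 := hlower n hn0.le
      ((bestPEIPCost μ D (p * n) h (ce * n) le lr).toReal / (1 + ε)) fun s => by
        obtain ⟨s', hs', hle⟩ := hn s
        rw [div_le_iff₀' hε1]
        refine le_trans ?_ hle
        exact ENNReal.toReal_le_of_le_ofReal (newsvendorCost_nonneg hh.le (by positivity) _)
          (hupper n hn0.le s' hs')
    rw [ENNReal.ofReal_div_of_pos hε1, ENNReal.ofReal_toReal hbtop] at h1
    refine ENNReal.div_le_of_le_mul ?_
    have h2 := (ENNReal.div_le_iff (ENNReal.ofReal_pos.2 hε1).ne' ENNReal.ofReal_ne_top).1 h1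
    exact h2.trans_eq (mul_comm _ _)
  refine tendsto_order.2 ⟨fun a ha => ?_, fun a ha => ?_⟩
  · filter_upwards [eventually_gt_atTop 0] with n hn
    refine ha.trans_le ?_
    rw [ENNReal.le_div_iff_mul_le (Or.inl (hpos n hn)) (Or.inl (htop n hn.le)), one_mul]
    exact optimalCost_le_bestPEIPCost μ D _ _ _ le lr
  · have hlim : Tendsto (fun ε : ℝ => ENNReal.ofReal (1 + ε)) (𝓝[>] 0) (𝓝 1) := by
      have : Tendsto (fun ε : ℝ => 1 + ε) (𝓝[>] 0) (𝓝 (1 + 0)) :=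
        (tendsto_const_nhds.add tendsto_id).mono_left nhdsWithin_le_nhds
      simpa using ENNReal.tendsto_ofReal this
    obtain ⟨ε, hε, hε0⟩ := ((hlim.eventually (gt_mem_nhds ha)).and self_mem_nhdsWithin).exists
    filter_upwards [hratio_le ε hε0] with n hn using hn.trans_lt hε
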